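/- **Model.** Let $V=V_1\sqcup V_2$ be a finite vertex set with $n=|V|$, and let $d:V\to\{2,3,\dots\}$ be such that $N_i=\sum_{v\in V_i}d(v)$ is even for $i=1,2$; put $N=N_1+N_2$. Let $p$ be an even integer with $2\le p\le\min\{N_1,N_2\}$. Attach $d(v)$ half-edges to every $v\in V$. In each community choose $p$ half-edges uniformly at random and call them outgoing; call the remaining ones internal. Match the outgoing half-edges of $V_1$ with those of $V_2$ by a uniformly random bijection and, for each $i$, match the internal half-edges of $V_i$ by a uniformly random perfect matching (all choices being independent given the previous ones). The resulting random multigraph $G$ is the two communities random graph. Put $\alpha=\frac{p}{N_1}+\frac{p}{N_2}$. **Spectral profile.** Let $P$ be the transition matrix of the lazy simple random walk on $G$ (with probability $1/2$ stay; otherwise move along a uniformly chosen half-edge at the current vertex), which is reversible with respect to $\pi(x)=d(x)/N$. For nonempty $A\subseteq V$ let $P_A$ be the restriction of $P$ to $A$ and $\lambda(A)=1-\max\{\mu:\mu\text{ is an eigenvalue of }P_A\}$. With $\pi_*=\min_x\pi(x)$ let $$\Lambda(r)=\inf\{\lambda(A):\ \pi_*\le\pi(A)\le r\}.$$ **Proposition.**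 For every $\Delta\in\mathbb N$, $\kappa>0$ and $a>0$ there is a constant $c=c(\Delta,\kappa,a)>0$ such that the following holds. Let $(G_k)_{k\ge 0}$ be a sequence of two communities random graphs whose parameters satisfy $n_k=|V^{(k)}|\to\infty$ and, for every $k$, $$\alpha_k\le 1,\qquad \min\{N_1^{(k)},N_2^{(k)}\}\ge\kappa N^{(k)},\qquad 3\le d^{(k)}(v)\le\Delta\ \text{ for all } v\in V^{(k)},\qquad \alpha_k\ge\frac{a}{\log n_k}.$$ Then $$\mathbb P\big(\Lambda_{G_k}(1/2)\ge c\,\alpha_k\big)\longrightarrow 1\qquad\text{as }k\to\infty .$$ In other words, with high probability every nonempty set of vertices of stationary measure at most $1/2$ has Dirichlet eigenvalue at least $c\,\alpha_k$. -/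

import Mathlib

open Filter Topology
open scoped ENNReal

universe u

noncomputable section

/-! ### Dirichlet eigenvalues and the spectral profile of a finite chain -/

/-- The Dirichlet eigenvalue `λ(A) = 1 - max {μ : μ eigenvalue of P_A}`, where `P_A` is the
restriction of the transition matrix `P` to `A`. (For a reversible chain and nonempty `A` the set of
real eigenvalues of `P_A` is finite and nonempty, so the supremum is a maximum.) -/
def dirichletEigenvalue {S : Type u} [Fintype S] [DecidableEq S] (P : Matrix S S ℝ)
    (A : Finset S) : ℝ :=
  1 - sSup {μ : ℝ | Module.End.HasEigenvalue
    (Matrix.toLin' (P.submatrix (fun x : A => (x : S)) (fun x : A => (x : S)))) μ}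

/-- The spectral profile `Λ(r) = inf {λ(A) : π_* ≤ π(A) ≤ r}`, with `π_* = min_x π(x)`. -/
def spectralProfile {S : Type u} [Fintype S] [DecidableEq S] (P : Matrix S S ℝ) (π : S → ℝ)
    (r : ℝ) : ℝ :=
  sInf (dirichletEigenvalue P ''
    {A : Finset S | (⨅ x, π x) ≤ ∑ x ∈ A, π x ∧ ∑ x ∈ A, π x ≤ r})

/-! ### Perfect matchings of a finite set -/

/-- A perfect matching of `X`, given as the map sending each element to its partner. -/
abbrev PerfectMatching (X : Type u) : Type u :=
  {m : X → X // ∀ x, m (m x) = x ∧ m x ≠ x}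

theorem PerfectMatching.nonempty_of_even {X : Type u} [Fintype X] (h : Even (Fintype.card X)) :
    Nonempty (PerfectMatching X) := by
  obtain ⟨k, hk⟩ := h
  have e : X ≃ Fin k × Bool := Fintype.equivOfCardEq (by simp [hk, mul_two])
  refine ⟨⟨fun x => e.symm ((e x).1, !(e x).2), fun x => ⟨by simp, fun hx => ?_⟩⟩⟩
  have h2 := congrArg (fun y => (e y).2) hx
  simp at h2

/-! ### The two communities random graph -/

/-- The deterministic data of the two communities model: the two communities, the degrees and the
number `p` of outgoing half-edges in each community. -/
structure TwoCommunities : Type (u + 1) where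
  V₁ : Type u
  V₂ : Type u
  [fintype₁ : Fintype V₁]
  [fintype₂ : Fintype V₂]
  [decEq₁ : DecidableEq V₁]
  [decEq₂ : DecidableEq V₂]
  d₁ : V₁ → ℕ
  d₂ : V₂ → ℕ
  two_le_d₁ : ∀ v, 2 ≤ d₁ v
  two_le_d₂ : ∀ v, 2 ≤ d₂ v
  even_N₁ : Even (∑ v, d₁ v)
  even_N₂ : Even (∑ v, d₂ v)
  p : ℕ
  even_p : Even p
  two_le_p : 2 ≤ p
  p_le_N₁ : p ≤ ∑ v, d₁ v
  p_le_N₂ : p ≤ ∑ v, d₂ v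

namespace TwoCommunities

attribute [instance] fintype₁ fintype₂ decEq₁ decEq₂

variable (M : TwoCommunities.{u})

/-- The vertex set, the disjoint union of the two communities. -/
abbrev V : Type u := M.V₁ ⊕ M.V₂

/-- The degree of a vertex. -/
def d : M.V → ℕ := Sum.elim M.d₁ M.d₂

/-- The number of vertices. -/
def n : ℕ := Fintype.card M.V

def N₁ : ℕ := ∑ v, M.d₁ v

def N₂ : ℕ := ∑ v, M.d₂ v

def N : ℕ := M.N₁ + M.N₂

/-- `α = α₁ + α₂` with `αᵢ = p / Nᵢ`. -/
def α : ℝ := (M.p : ℝ) / M.N₁ + (M.p : ℝ) / M.N₂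

/-- The half-edges of the first community. -/
abbrev H₁ : Type u := Σ v : M.V₁, Fin (M.d₁ v)

/-- The half-edges of the second community. -/
abbrev H₂ : Type u := Σ v : M.V₂, Fin (M.d₂ v)

/-- All half-edges. -/
abbrev H : Type u := M.H₁ ⊕ M.H₂

/-- The vertex to which a half-edge is attached. -/
def vertex : M.H → M.V := Sum.map Sigma.fst Sigma.fst

/-- The possible sets of outgoing half-edges in the first community. -/
abbrev Outgoing₁ : Type u := {O : Finset M.H₁ // O.card = M.p}

/-- The possible sets of outgoing half-edges in the second community. -/
abbrev Outgoing₂ : Type u := {O : Finset M.H₂ // O.card = M.p}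

instance : Nonempty M.Outgoing₁ := by
  obtain ⟨O, -, hO⟩ := Finset.exists_subset_card_eq
    (s := (Finset.univ : Finset M.H₁)) (n := M.p) (by simpa using M.p_le_N₁)
  exact ⟨⟨O, hO⟩⟩

instance : Nonempty M.Outgoing₂ := by
  obtain ⟨O, -, hO⟩ := Finset.exists_subset_card_eq
    (s := (Finset.univ : Finset M.H₂)) (n := M.p) (by simpa using M.p_le_N₂)
  exact ⟨⟨O, hO⟩⟩

variable {M}

/-- The internal half-edges of the first community. -/
abbrev Internal₁ (O : M.Outgoing₁) : Type u := {h : M.H₁ // h ∉ O.1}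

/-- The internal half-edges of the second community. -/
abbrev Internal₂ (O : M.Outgoing₂) : Type u := {h : M.H₂ // h ∉ O.1}

instance (O₁ : M.Outgoing₁) (O₂ : M.Outgoing₂) : Nonempty (O₁.1 ≃ O₂.1) :=
  ⟨Finset.equivOfCardEq (O₁.2.trans O₂.2.symm)⟩

instance (O : M.Outgoing₁) : Nonempty (PerfectMatching (Internal₁ O)) := by
  apply PerfectMatching.nonempty_of_even
  rw [Fintype.card_subtype_compl, Fintype.card_coe, O.2]
  simpa using (Nat.even_sub M.p_le_N₁).2 (by simp [M.even_N₁, M.even_p])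

instance (O : M.Outgoing₂) : Nonempty (PerfectMatching (Internal₂ O)) := by
  apply PerfectMatching.nonempty_of_even
  rw [Fintype.card_subtype_compl, Fintype.card_coe, O.2]
  simpa using (Nat.even_sub M.p_le_N₂).2 (by simp [M.even_N₂, M.even_p])

/-- The pairing of all half-edges given by a matching of the outgoing half-edges of the two
communities and perfect matchings of the internal half-edges in each community. -/
def pairing (O₁ : M.Outgoing₁) (O₂ : M.Outgoing₂) (b : O₁.1 ≃ O₂.1)
    (m₁ : PerfectMatching (Internal₁ O₁)) (m₂ : PerfectMatching (Internal₂ O₂)) : M.H → M.H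
  | Sum.inl h => if hh : h ∈ O₁.1 then Sum.inr (b ⟨h, hh⟩) else Sum.inl (m₁.1 ⟨h, hh⟩)
  | Sum.inr h => if hh : h ∈ O₂.1 then Sum.inl (b.symm ⟨h, hh⟩) else Sum.inr (m₂.1 ⟨h, hh⟩)

variable (M)

/-- The law of the random graph, as the random pairing of the half-edges: choose `p` outgoing
half-edges uniformly in each community, match the outgoing half-edges of the two communities
uniformly at random, and take uniform perfect matchings of the internal half-edges. -/
def law : PMF (M.H → M.H) :=
  (PMF.uniformOfFintype M.Outgoing₁).bind fun O₁ =>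
  (PMF.uniformOfFintype M.Outgoing₂).bind fun O₂ =>
  (PMF.uniformOfFintype (O₁.1 ≃ O₂.1)).bind fun b =>
  (PMF.uniformOfFintype (PerfectMatching (Internal₁ O₁))).bind fun m₁ =>
  (PMF.uniformOfFintype (PerfectMatching (Internal₂ O₂))).map fun m₂ =>
    pairing O₁ O₂ b m₁ m₂

variable {M}

/-- The transition matrix of the lazy simple random walk on the multigraph given by the pairing `σ`:
with probability `1/2` stay put, otherwise move along a uniformly chosen half-edge at `x` to the
vertex of its partner. -/
def lazyWalk (σ : M.H → M.H) : Matrix M.V M.V ℝ := fun x y =>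
  (if x = y then 1 / 2 else 0) +
    1 / 2 * (((Finset.univ.filter fun h : M.H =>
      M.vertex h = x ∧ M.vertex (σ h) = y).card : ℝ) / M.d x)

variable (M)

/-- The stationary distribution `π(x) = d(x) / N` of the walk. -/
def stationary (x : M.V) : ℝ := (M.d x : ℝ) / M.N

end TwoCommunities

end

/-! By the variational identity for an eigenfunction of `P_A`, it suffices to bound the Dirichlet
energy `∑ (f(v h) - f(v (σ h)))²` over half-edges from below by a multiple of `α ∑ f(v h)²`, for
nonnegative `f` supported on at most half of the volume. Cheeger's inequality would only give `α²`,
because a whole community is a set with conductance of order `α`.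

The linear rate comes from a Cheeger argument relative to the communities
(`energy_ge_of_expansion`). One community has at least half of its volume outside the support of
`f`, so `0` is a median there; let `m` be a median on the other one, `X`. The function `f` is
compared with the profile equal to `m` on `X` and `0` elsewhere. After a reparametrization
`profileMap` whose derivative vanishes at both `0` and `m`, the coarea formula is applied. Low level
sets are close to `X` (twisted), high ones are small in both communities (aligned). Aligned sets
have boundary proportional to their volume, twisted ones proportional to `p` plus the volume of
their difference from `X`. Cauchy–Schwarz then loses only a constant, and `p` enters linearly.

Expansion is a first moment bound. The law of the pairing is invariant under permuting half-edges
within each community, so the generating function of the cut of a set of half-edges depends only on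
its sizes `s₁`, `s₂` in the communities. It can be averaged over all sets of those sizes, and for
each fixed pairing the sum over all sets factorizes over edges (`sum_prod_cut_le`). With `W = exp(N
H(s/N))` in each community, this saddle point bound gives roughly `W^(-1/2)` for a fixed set
(`cutGen_le`), and a Chernoff bound with small expansion constant costs `W^(1/12)`. Since degrees
are at least three there are at most `W^(1/3)` vertex sets of volume `s` (`card_volume_eq_le`). As
`1/3 + 1/12 < 1/2`, the union bound over nonempty sets tends to zero. Twisted sets too close to a
community for this estimate are handled deterministically: most of the crossing edges are still cut.
-/

/-! ### Coarea and the two-community Poincaré inequality -/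

/-- The indicator of `t < a`. -/
noncomputable def step (t a : ℝ) : ℝ := if t < a then 1 else 0

theorem integral_abs_step_sub_step {a b K : ℝ} (ha : 0 ≤ a) (hb : 0 ≤ b) (haK : a ≤ K)
    (hbK : b ≤ K) :
    IntervalIntegrable (fun t => |step t a - step t b|) MeasureTheory.volume 0 K ∧
      ∫ t in (0 : ℝ)..K, |step t a - step t b| = |a - b| := by
  wlog hab : a ≤ b generalizing a b
  · have := this hb ha hbK haK (le_of_not_ge hab)
    simpa only [abs_sub_comm] using this
  have hfun : (fun t => |step t a - step t b|) = Set.indicator (Set.Ico a b) (fun _ => (1 : ℝ)) := by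
    funext t
    by_cases h1 : t < a
    · have h2 : t < b := by linarith
      simp [step, h1, h2, Set.indicator]
    · by_cases h2 : t < b
      · simp [step, h1, h2, Set.indicator, not_lt.1 h1]
      · simp [step, h1, h2, Set.indicator]
  have hK : 0 ≤ K := ha.trans haK
  rw [hfun]
  constructor
  · rw [intervalIntegrable_iff]
    exact ((intervalIntegrable_iff.1 intervalIntegrable_const).indicator measurableSet_Ico)
  · rw [intervalIntegral.integral_of_le hK, ← MeasureTheory.integral_Icc_eq_integral_Ioc,
      MeasureTheory.integral_indicator measurableSet_Ico,
      MeasureTheory.Measure.restrict_restrict measurableSet_Ico,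
      Set.inter_eq_left.2 (show Set.Ico a b ⊆ Set.Icc 0 K from
        fun t ht => ⟨ha.trans ht.1, ht.2.le.trans hbK⟩)]
    simp [hab, abs_sub_comm a b, abs_of_nonneg]

/-- Integrating the level-set inequality `hlev` over `t` recovers all the absolute differences,
since the integral of `|step t a - step t b|` is `|a - b|`. The cutoff `K` only has to exceed every
value involved. -/
theorem coarea_lower_bound {H : Type*} [Fintype H] (σ : H → H) (b : H → ℝ) (w : H → ℝ)
    (hw : ∀ h, 0 ≤ w h) (hb : ∀ h, 0 ≤ b h) {ε p M : ℝ} (hM : 0 ≤ M)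
    (hlev : ∀ t, 0 ≤ t → ε * (p * step t M + ∑ h, |step t (w h) - step t (b h)|) ≤
      ∑ h, |step t (w h) - step t (w (σ h))|) :
    ε * (p * M + ∑ h, |w h - b h|) ≤ ∑ h, |w h - w (σ h)| := by
  set K : ℝ := M + ∑ h, w h + ∑ h, b h with hK
  have hsw : 0 ≤ ∑ h, w h := Finset.sum_nonneg fun h _ => hw h
  have hsb : 0 ≤ ∑ h, b h := Finset.sum_nonneg fun h _ => hb h
  have hwK : ∀ h, w h ≤ K := fun h => by
    have := Finset.single_le_sum (fun h _ => hw h) (Finset.mem_univ h); linarith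
  have hbK : ∀ h, b h ≤ K := fun h => by
    have := Finset.single_le_sum (fun h _ => hb h) (Finset.mem_univ h); linarith
  have hMK : M ≤ K := by linarith
  have hK0 : 0 ≤ K := by linarith
  have hMi := integral_abs_step_sub_step hM le_rfl hMK hK0
  have hwb := fun h => integral_abs_step_sub_step (hw h) (hb h) (hwK h) (hbK h)
  have hww := fun h => integral_abs_step_sub_step (hw h) (hw (σ h)) (hwK h) (hwK (σ h))
  have hwbs : IntervalIntegrable (fun t => ∑ h, |step t (w h) - step t (b h)|)
      MeasureTheory.volume 0 K := by
    simpa only [Finset.sum_fn] using IntervalIntegrable.sum Finset.univ fun h _ => (hwb h).1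
  have hi1 : IntervalIntegrable (fun t => ε * (p * |step t M - step t 0| +
      ∑ h, |step t (w h) - step t (b h)|)) MeasureTheory.volume 0 K :=
    ((hMi.1.const_mul p).add hwbs).const_mul ε
  have hi2 : IntervalIntegrable (fun t => ∑ h, |step t (w h) - step t (w (σ h))|)
      MeasureTheory.volume 0 K := by
    simpa only [Finset.sum_fn] using IntervalIntegrable.sum Finset.univ fun h _ => (hww h).1
  have hmono := intervalIntegral.integral_mono_on hK0 hi1 hi2 (fun t ht => by
    have h0 : |step t M - step t 0| = step t M := by
      have : step t 0 = 0 := by simp [step, ht.1]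
      rw [this, sub_zero, abs_of_nonneg]
      unfold step; split_ifs <;> norm_num
    rw [h0]
    exact hlev t ht.1)
  rw [intervalIntegral.integral_const_mul, intervalIntegral.integral_add (hMi.1.const_mul p)
    hwbs, intervalIntegral.integral_const_mul,
    intervalIntegral.integral_finsetSum (fun h _ => (hwb h).1),
    intervalIntegral.integral_finsetSum (fun h _ => (hww h).1), hMi.2] at hmono
  simpa [(hwb _).2, (hww _).2, abs_of_nonneg hM] using hmono

/-- A convex-concave-convex reparametrization adapted to the median `m`. -/
noncomputable def profileMap (m t : ℝ) : ℝ :=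
  if t ≤ m then 3 * t ^ 2 - 2 * t ^ 3 / m else m ^ 2 + (t - m) ^ 2

/-! ### Quadratic behaviour of the reparametrization near `0` and `m` -/

theorem profileMap_of_le {m t : ℝ} (h : t ≤ m) :
    profileMap m t = 3 * t ^ 2 - 2 * t ^ 3 / m := if_pos h

theorem profileMap_of_ge {m t : ℝ} (h0 : 0 ≤ m) (h : m ≤ t) :
    profileMap m t = m ^ 2 + (t - m) ^ 2 := by
  unfold profileMap
  split_ifs with h1
  · obtain rfl : t = m := le_antisymm h1 h
    rcases h0.eq_or_lt with h2 | h2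
    · subst h2; simp
    · field_simp; ring
  · rfl

theorem sq_le_profileMap {m t : ℝ} (ht : 0 ≤ t) (h : t ≤ m) : t ^ 2 ≤ profileMap m t := by
  rw [profileMap_of_le h]
  rcases (ht.trans h).eq_or_lt with h2 | h2
  · obtain rfl : t = 0 := le_antisymm (h.trans h2.symm.le) ht
    simp
  · have : 2 * t ^ 3 / m ≤ 2 * t ^ 2 := by
      rw [div_le_iff₀ h2]; nlinarith [sq_nonneg t]
    linarith

/-- Mirror image of `sq_le_profileMap`: on `[0, m]` the cubic satisfies `Φ(m - t) = m² - Φ(t)`. -/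
theorem profileMap_le_of_le {m t : ℝ} (ht : 0 ≤ t) (h : t ≤ m) :
    profileMap m t ≤ m ^ 2 - (m - t) ^ 2 := by
  rw [profileMap_of_le h]
  rcases (ht.trans h).eq_or_lt with h2 | h2
  · obtain rfl : t = 0 := le_antisymm (h.trans h2.symm.le) ht
    simp
  · have : 4 * t ^ 2 - 2 * m * t ≤ 2 * t ^ 3 / m := by
      rw [le_div_iff₀ h2]; nlinarith [mul_nonneg ht (sq_nonneg (m - t))]
    nlinarith

theorem profileMap_nonneg {m t : ℝ} (hm : 0 ≤ m) (ht : 0 ≤ t) : 0 ≤ profileMap m t := by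
  rcases le_total t m with h | h
  · exact (sq_nonneg t).trans (sq_le_profileMap ht h)
  · rw [profileMap_of_ge hm h]; positivity

theorem half_sq_le_profileMap {m t : ℝ} (hm : 0 ≤ m) (ht : 0 ≤ t) :
    t ^ 2 / 2 ≤ profileMap m t := by
  rcases le_total t m with h | h
  · have := sq_le_profileMap ht h; nlinarith [sq_nonneg t]
  · rw [profileMap_of_ge hm h]; nlinarith [sq_nonneg (t - 2 * m)]

theorem sq_sub_le_abs_profileMap {m t : ℝ} (hm : 0 ≤ m) (ht : 0 ≤ t) :
    (t - m) ^ 2 ≤ |profileMap m t - m ^ 2| := by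
  rcases le_total t m with h | h
  · have := profileMap_le_of_le ht h
    rw [abs_of_nonpos (by nlinarith [sq_nonneg (m - t)])]; nlinarith
  · rw [profileMap_of_ge hm h]; simp [abs_of_nonneg, sq_nonneg]

theorem sq_sub_profileMap_le {m t : ℝ} (ht : 0 ≤ t) (h : t ≤ m) :
    m ^ 2 - profileMap m t ≤ 3 * (m - t) ^ 2 := by
  rw [profileMap_of_le h]
  rcases (ht.trans h).eq_or_lt with h2 | h2
  · obtain rfl : t = 0 := le_antisymm (h.trans h2.symm.le) ht
    simp [← h2]
  · have : 2 * t ^ 3 / m ≤ 2 * m ^ 2 - 6 * m * t + 6 * t ^ 2 := by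
      rw [div_le_iff₀ h2]
      have := pow_nonneg (sub_nonneg.2 h) 3
      nlinarith
    nlinarith

/-- Increments of `profileMap` are controlled near both `0` and `m`. -/
theorem abs_profileMap_sub_le {m s t : ℝ} (hm : 0 ≤ m) (hs : 0 ≤ s) (ht : 0 ≤ t) {r : ℝ}
    (hr : r = s ∨ r = |s - m|) :
    |profileMap m s - profileMap m t| ≤ 6 * |s - t| * (r + |s - t|) := by
  have hr0 : 0 ≤ r := by rcases hr with rfl | rfl <;> positivity
  -- Across `m` both pieces are quadratic in the distance to `m`, and these distances add up to `y -
  -- x`.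
  have hcross : ∀ x y : ℝ, 0 ≤ x → x ≤ m → m ≤ y → |profileMap m y - profileMap m x| ≤
      3 * |y - x| ^ 2 := by
    intro x y hx hxm hmy
    have h1 := sq_sub_profileMap_le hx hxm
    have h2 := profileMap_le_of_le hx hxm
    rw [profileMap_of_ge hm hmy, abs_of_nonneg (by nlinarith [sq_nonneg (y - m), sq_nonneg (m - x)]),
      abs_of_nonneg (by linarith)]
    nlinarith [mul_nonneg (sub_nonneg.2 hxm) (sub_nonneg.2 hmy), sq_nonneg (y - m)]
  have habs := abs_nonneg (s - t)
  have hfin : 3 * |s - t| ^ 2 ≤ 6 * |s - t| * (r + |s - t|) := by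
    nlinarith [mul_nonneg habs hr0, sq_nonneg (|s - t|)]
  rcases le_total s m with hsm | hsm <;> rcases le_total t m with htm | htm
  · rcases hm.eq_or_lt with h0 | h0
    · have hs' : s = 0 := by linarith
      have ht' : t = 0 := by linarith
      simp [hs', ht']
    · have key : profileMap m s - profileMap m t =
          (s - t) * ((3 * (s + t) * m - 2 * (s ^ 2 + s * t + t ^ 2)) / m) := by
        rw [profileMap_of_le hsm, profileMap_of_le htm]
        field_simp
        ring
      have e1 := mul_nonneg hs (sub_nonneg.2 hsm)
      have e2 := mul_nonneg ht (sub_nonneg.2 htm)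
      have e3 := mul_nonneg hs (sub_nonneg.2 htm)
      have e4 := mul_nonneg ht (sub_nonneg.2 hsm)
      have e5 := mul_nonneg hs ht
      have e6 := mul_nonneg (sub_nonneg.2 hsm) (sub_nonneg.2 htm)
      have hA0 : 0 ≤ (3 * (s + t) * m - 2 * (s ^ 2 + s * t + t ^ 2)) / m :=
        div_nonneg (by nlinarith) hm
      have hA1 : (3 * (s + t) * m - 2 * (s ^ 2 + s * t + t ^ 2)) / m ≤ 3 * (s + t) := by
        rw [div_le_iff₀ h0]; nlinarith [sq_nonneg s, sq_nonneg t]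
      -- The difference quotient of the cubic is small near `0` by `hA1` and near `m` by `hA2`; `hr`
      -- selects which of the two is needed.
      have hA2 : (3 * (s + t) * m - 2 * (s ^ 2 + s * t + t ^ 2)) / m ≤
          3 * ((m - s) + (m - t)) := by
        rw [div_le_iff₀ h0]; nlinarith [sq_nonneg (m - s), sq_nonneg (m - t)]
      rw [key, abs_mul, abs_of_nonneg hA0]
      have hle := le_abs_self (s - t)
      have hle' := neg_abs_le (s - t)
      have : (3 * (s + t) * m - 2 * (s ^ 2 + s * t + t ^ 2)) / m ≤ 6 * (r + |s - t|) := by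
        rcases hr with rfl | rfl
        · linarith
        · rw [abs_of_nonpos (sub_nonpos.2 hsm)]; linarith
      calc _ ≤ |s - t| * (6 * (r + |s - t|)) := mul_le_mul_of_nonneg_left this habs
        _ = _ := by ring
  · rw [abs_sub_comm, abs_sub_comm s t] at *
    exact (hcross s t hs hsm htm).trans hfin
  · exact (hcross t s ht htm hsm).trans hfin
  · have key : profileMap m s - profileMap m t = (s - t) * (s + t - 2 * m) := by
      rw [profileMap_of_ge hm hsm, profileMap_of_ge hm htm]; ring
    rw [key, abs_mul, abs_of_nonneg (by linarith : 0 ≤ s + t - 2 * m)]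
    have hle' := neg_abs_le (s - t)
    have : s + t - 2 * m ≤ 6 * (r + |s - t|) := by
      rcases hr with rfl | rfl
      · linarith
      · rw [abs_of_nonneg (sub_nonneg.2 hsm)]; linarith
    calc _ ≤ |s - t| * (6 * (r + |s - t|)) := mul_le_mul_of_nonneg_left this habs
      _ = _ := by ring

/-- Take the largest value having at most half of the points strictly below it. The next larger
value fails this, so at least half of the points lie at or below the chosen one. -/
theorem exists_median {H : Type*} (X : Finset H) (hX : X.Nonempty) (f : H → ℝ) :
    ∃ x ∈ X, 2 * (X.filter fun h => f h < f x).card ≤ X.card ∧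
      2 * (X.filter fun h => f x < f h).card ≤ X.card := by
  classical
  obtain ⟨y, hy, hmin⟩ := X.exists_min_image f hX
  have hne : (X.filter fun x => 2 * (X.filter fun h => f h < f x).card ≤ X.card).Nonempty := by
    refine ⟨y, Finset.mem_filter.2 ⟨hy, ?_⟩⟩
    rw [Finset.filter_eq_empty_iff.2 fun h hh => not_lt.2 (hmin h hh)]
    simp
  obtain ⟨x, hx, hmax⟩ := Finset.exists_max_image _ f hne
  rw [Finset.mem_filter] at hx
  refine ⟨x, hx.1, hx.2, ?_⟩
  by_cases hE : (X.filter fun h => f x < f h).Nonempty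
  · obtain ⟨z, hz, hzmin⟩ := Finset.exists_min_image _ f hE
    rw [Finset.mem_filter] at hz
    have h1 : ¬ 2 * (X.filter fun h => f h < f z).card ≤ X.card := fun hc =>
      absurd (hmax z (Finset.mem_filter.2 ⟨hz.1, hc⟩)) (not_le.2 hz.2)
    have h2 : (X.filter fun h => f h < f z).card ≤ (X.filter fun h => ¬ f x < f h).card := by
      refine Finset.card_le_card fun h hh => ?_
      rw [Finset.mem_filter] at hh ⊢
      exact ⟨hh.1, fun hlt => absurd (hzmin h (Finset.mem_filter.2 ⟨hh.1, hlt⟩)) (not_le.2 hh.2)⟩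
    have h3 := X.card_filter_add_card_filter_not (fun h => f x < f h)
    omega
  · rw [Finset.not_nonempty_iff_eq_empty.1 hE]; simp

theorem abs_step_sub_step (t a b : ℝ) :
    |step t a - step t b| = if ¬ (t < a ↔ t < b) then 1 else 0 := by
  unfold step
  by_cases h1 : t < a <;> by_cases h2 : t < b <;> simp [h1, h2]

theorem sum_abs_step_sub_step {H : Type*} [Fintype H] (t : ℝ) (a b : H → ℝ) :
    ∑ h, |step t (a h) - step t (b h)| =
      ((Finset.univ.filter fun h => ¬ (t < a h ↔ t < b h)).card : ℝ) := by
  simp_rw [abs_step_sub_step]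
  rw [Finset.sum_ite, Finset.sum_const_zero, add_zero, Finset.sum_const, nsmul_eq_mul, mul_one]

/-- Poincaré inequality for functions with small support in one of two communities, from the
expansion of sets which are small in both communities (`haligned`) and of sets which are large in
one community and small in the other (`htwisted`). -/
theorem energy_ge_of_expansion {H V : Type*} [Fintype H] [DecidableEq H] [Fintype V]
    [DecidableEq V] (σ : H → H) (v : H → V) (X : Finset H) (hX : X.Nonempty) (p : ℕ)
    (hp : p ≤ Fintype.card H) {ε : ℝ} (hε : 0 < ε)
    (haligned : ∀ A : Finset V, 2 * (X.filter fun h => v h ∈ A).card ≤ X.card →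
      2 * (Xᶜ.filter fun h => v h ∈ A).card ≤ Xᶜ.card →
      ε * (Finset.univ.filter fun h => v h ∈ A).card ≤
        (Finset.univ.filter fun h => ¬ (v h ∈ A ↔ v (σ h) ∈ A)).card)
    (htwisted : ∀ A : Finset V, 2 * (X.filter fun h => v h ∉ A).card ≤ X.card →
      2 * (Xᶜ.filter fun h => v h ∈ A).card ≤ Xᶜ.card →
      ε * (p + (X.filter fun h => v h ∉ A).card + (Xᶜ.filter fun h => v h ∈ A).card) ≤
        (Finset.univ.filter fun h => ¬ (v h ∈ A ↔ v (σ h) ∈ A)).card)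
    (f : V → ℝ) (hf : ∀ x, 0 ≤ f x)
    (hsupp : 2 * (Xᶜ.filter fun h => f (v h) ≠ 0).card ≤ Xᶜ.card) :
    ε / (8 * (36 / ε + 6)) * (p / Fintype.card H) * ∑ h, f (v h) ^ 2 ≤
      ∑ h, (f (v h) - f (v (σ h))) ^ 2 := by
  obtain ⟨x₀, hx₀, hlow, hupp⟩ := exists_median X hX (fun h => f (v h))
  set m := f (v x₀) with hm
  have hm0 : 0 ≤ m := hf _
  set w : H → ℝ := fun h => profileMap m (f (v h)) with hw
  set b : H → ℝ := fun h => if h ∈ X then m ^ 2 else 0 with hb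
  have hw0 : ∀ h, 0 ≤ w h := fun h => profileMap_nonneg hm0 (hf _)
  have hb0 : ∀ h, 0 ≤ b h := fun h => by simp only [hb]; split_ifs <;> positivity
  have hge : ∀ x, m ≤ f x → m ^ 2 ≤ profileMap m (f x) := fun x hx => by
    rw [profileMap_of_ge hm0 hx]; nlinarith [sq_nonneg (f x - m)]
  have hle : ∀ x, f x ≤ m → profileMap m (f x) ≤ m ^ 2 := fun x hx => by
    have := profileMap_le_of_le (hf x) hx; nlinarith [sq_nonneg (m - f x)]
  have hcoarea : ε * (p * m ^ 2 + ∑ h, |w h - b h|) ≤ ∑ h, |w h - w (σ h)| := by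
    refine coarea_lower_bound σ b w hw0 hb0 (sq_nonneg m) fun t ht => ?_
    rw [sum_abs_step_sub_step, sum_abs_step_sub_step]
    set A : Finset V := Finset.univ.filter fun x => t < profileMap m (f x) with hA
    have hmem : ∀ h, v h ∈ A ↔ t < w h := fun h => by simp [hA, hw]
    -- Where `f` vanishes so does `w`, hence no level set with `t ≥ 0` meets the complement of the
    -- support.
    have hY : 2 * (Xᶜ.filter fun h => v h ∈ A).card ≤ Xᶜ.card := by
      refine le_trans (Nat.mul_le_mul_left 2 (Finset.card_le_card ?_)) hsupp
      refine Finset.monotone_filter_right _ fun h _ hh h0 => ?_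
      rw [hmem] at hh
      simp only [hw, h0] at hh
      rw [profileMap_of_le hm0] at hh
      norm_num at hh
      linarith
    -- Below `m²` the level set contains at least half of `X` and is twisted; from `m²` on it
    -- contains at most half of `X` and is aligned.
    by_cases htm : t < m ^ 2
    · have h1 : 2 * (X.filter fun h => v h ∉ A).card ≤ X.card := by
        refine le_trans (Nat.mul_le_mul_left 2 (Finset.card_le_card ?_)) hlow
        refine Finset.monotone_filter_right _ fun h _ hh => ?_
        rw [hmem] at hh
        by_contra hc
        exact hh (htm.trans_le (hge _ (not_lt.1 hc)))
      have h2 := htwisted A h1 hY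
      have h3 : (Finset.univ.filter fun h => ¬ (t < w h ↔ t < b h)).card =
          (X.filter fun h => v h ∉ A).card + (Xᶜ.filter fun h => v h ∈ A).card := by
        rw [← Finset.card_union_of_disjoint]
        · congr 1
          ext h
          by_cases hh : h ∈ X <;> simp [hh, hmem, hb, htm, not_lt.2 ht]
        · exact Finset.disjoint_filter_filter (disjoint_compl_right)
      simp only [hmem] at h2 h3
      rw [h3]
      simpa [step, htm, add_assoc] using h2
    · have h1 : 2 * (X.filter fun h => v h ∈ A).card ≤ X.card := by
        refine le_trans (Nat.mul_le_mul_left 2 (Finset.card_le_card ?_)) hupp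
        refine Finset.monotone_filter_right _ fun h _ hh => ?_
        rw [hmem] at hh
        by_contra hc
        exact htm (hh.trans_le (hle _ (not_lt.1 hc)))
      have h2 := haligned A h1 hY
      have h3 : ∀ h, ¬ t < b h := fun h => by
        simp only [hb]; split_ifs
        · exact htm
        · exact not_lt.2 ht
      simp only [hmem] at h2
      simpa [step, htm, h3] using h2
  -- The distance of `f` from the two-valued profile. It controls `|w - b|` from below through its
  -- square and the increments of `w` from above linearly.
  set ρ : H → ℝ := fun h => if h ∈ X then |f (v h) - m| else f (v h) with hρ
  set E := ∑ h, (f (v h) - f (v (σ h))) ^ 2 with hE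
  have hlo : (∑ h, ρ h ^ 2) / 2 ≤ ∑ h, |w h - b h| := by
    rw [Finset.sum_div]
    refine Finset.sum_le_sum fun h _ => ?_
    by_cases hh : h ∈ X
    · have := sq_sub_le_abs_profileMap hm0 (hf (v h))
      simp only [hρ, hb, hw, hh, if_true, sq_abs]
      nlinarith [sq_nonneg (f (v h) - m)]
    · simp only [hρ, hb, hw, hh, if_false, sub_zero]
      exact (half_sq_le_profileMap hm0 (hf _)).trans (le_abs_self _)
  have hup : ∑ h, |w h - w (σ h)| ≤ ε / 4 * (∑ h, ρ h ^ 2) + (36 / ε + 6) * E := by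
    rw [Finset.mul_sum, hE, Finset.mul_sum, ← Finset.sum_add_distrib]
    refine Finset.sum_le_sum fun h _ => ?_
    have h1 := abs_profileMap_sub_le (r := ρ h) hm0 (hf (v h)) (hf (v (σ h))) (by
      by_cases hh : h ∈ X <;> simp [hρ, hh])
    refine h1.trans ?_
    rw [← sq_abs (f (v h) - f (v (σ h)))]
    set D := |f (v h) - f (v (σ h))|
    -- Young's inequality with weight `ε / 4`: half of the term `ε / 2 * ∑ ρ²` supplied by the
    -- coarea bound survives the absorption.
    have h2 : 6 * D * ρ h ≤ ε / 4 * ρ h ^ 2 + 36 / ε * D ^ 2 := by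
      have : ε / 4 * ρ h ^ 2 + 36 / ε * D ^ 2 - 6 * D * ρ h = (ε * ρ h - 12 * D) ^ 2 / (4 * ε) := by
        field_simp
        ring
      have h3 : 0 ≤ (ε * ρ h - 12 * D) ^ 2 / (4 * ε) := by positivity
      linarith
    nlinarith
  have hN : (0 : ℝ) < Fintype.card H := by
    have : 0 < Fintype.card H := Fintype.card_pos_iff.2 ⟨x₀⟩
    exact_mod_cast this
  have hsum : ∑ h, f (v h) ^ 2 ≤ 2 * ∑ h, ρ h ^ 2 + 2 * (Fintype.card H * m ^ 2) := by
    have : (Fintype.card H : ℝ) * m ^ 2 = ∑ _h : H, m ^ 2 := by simp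
    rw [this, Finset.mul_sum, Finset.mul_sum, ← Finset.sum_add_distrib]
    refine Finset.sum_le_sum fun h _ => ?_
    by_cases hh : h ∈ X
    · simp only [hρ, hh, if_true, sq_abs]; nlinarith [sq_nonneg (f (v h) - 2 * m)]
    · simp only [hρ, hh, if_false]; nlinarith [sq_nonneg (f (v h)), sq_nonneg m]
  have hρ0 : 0 ≤ ∑ h, ρ h ^ 2 := Finset.sum_nonneg fun h _ => sq_nonneg _
  have hq1 : (p : ℝ) / Fintype.card H ≤ 1 := by
    rw [div_le_one hN]; exact_mod_cast hp
  have hq0 : 0 ≤ (p : ℝ) / Fintype.card H := by positivity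
  have hmain : (p : ℝ) / Fintype.card H * ∑ h, f (v h) ^ 2 ≤
      8 * (p * m ^ 2 + (∑ h, ρ h ^ 2) / 4) := by
    have h1 := mul_le_mul_of_nonneg_left hsum hq0
    have h2 : (p : ℝ) / Fintype.card H * (2 * (Fintype.card H * m ^ 2)) = 2 * (p * m ^ 2) := by
      field_simp
    have h3 := mul_le_mul_of_nonneg_right hq1 hρ0
    have h4 : 0 ≤ (p : ℝ) * m ^ 2 := by positivity
    nlinarith
  have hfinal : ε * (p * m ^ 2 + (∑ h, ρ h ^ 2) / 4) ≤ (36 / ε + 6) * E := by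
    have := mul_le_mul_of_nonneg_left hlo hε.le
    nlinarith
  have hC : 0 < 36 / ε + 6 := by positivity
  rw [mul_assoc, div_mul_eq_mul_div, div_le_iff₀ (by positivity)]
  nlinarith [mul_le_mul_of_nonneg_left hmain hε.le]

/-! ### Dirichlet eigenvalues of the lazy walk -/

namespace TwoCommunities

variable {M : TwoCommunities.{u}}

theorem card_H₁ : Fintype.card M.H₁ = M.N₁ := by simp [N₁]

theorem card_H₂ : Fintype.card M.H₂ = M.N₂ := by simp [N₂]

theorem card_H : Fintype.card M.H = M.N := by
  rw [Fintype.card_sum, card_H₁, card_H₂, N]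

theorem two_le_d (x : M.V) : 2 ≤ M.d x := by
  rcases x with x | x
  · exact M.two_le_d₁ x
  · exact M.two_le_d₂ x

theorem N_pos : 0 < M.N := by
  have h1 := M.two_le_p
  have h2 := M.p_le_N₁
  unfold N N₁
  omega

theorem p_le_N : M.p ≤ M.N := by
  have h2 := M.p_le_N₁
  unfold N N₁
  omega

theorem sum_halfEdge (F : M.V → ℝ) : ∑ h : M.H, F (M.vertex h) = ∑ x, M.d x * F x := by
  simp [Fintype.sum_sum_type, Fintype.sum_sigma, vertex, d]

theorem sum_d : ∑ x, M.d x = M.N := by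
  simp [Fintype.sum_sum_type, d, N, N₁, N₂]

theorem sum_mul_lazyWalk (σ : M.H → M.H) (f : M.V → ℝ) :
    ∑ x, M.d x * (f x * ∑ y, lazyWalk σ x y * f y) =
      (∑ h, f (M.vertex h) ^ 2 + ∑ h, f (M.vertex h) * f (M.vertex (σ h))) / 2 := by
  have h1 : ∀ x y, M.d x * (f x * (lazyWalk σ x y * f y)) =
      (if x = y then M.d x * f x ^ 2 / 2 else 0) + (∑ h, if M.vertex h = x ∧ M.vertex (σ h) = y then
        f x * f y / 2 else 0) := by
    intro x y
    have hd : (M.d x : ℝ) ≠ 0 := by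
      have := two_le_d x
      exact_mod_cast (by omega : M.d x ≠ 0)
    rw [← Finset.sum_filter, Finset.sum_const, nsmul_eq_mul]
    unfold lazyWalk
    by_cases hxy : x = y
    · subst hxy
      simp only [if_true]
      field_simp
    · simp only [hxy, if_false]
      field_simp
      ring
  simp_rw [Finset.mul_sum, h1, Finset.sum_add_distrib]
  rw [add_div]
  congr 1
  · simp only [Finset.sum_ite_eq, Finset.mem_univ, if_true]
    rw [sum_halfEdge (fun x => f x ^ 2), Finset.sum_div]
  · have : ∀ x, ∑ y, ∑ h, (if M.vertex h = x ∧ M.vertex (σ h) = y then f x * f y / 2 else 0) =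
        ∑ h, ∑ y, (if M.vertex h = x ∧ M.vertex (σ h) = y then f x * f y / 2 else 0) :=
      fun x => Finset.sum_comm
    simp_rw [this]
    rw [Finset.sum_comm, Finset.sum_div]
    refine Finset.sum_congr rfl fun h _ => ?_
    simp_rw [ite_and]
    rw [Finset.sum_eq_single (M.vertex h)]
    · simp
    · intro x _ hx
      simp [hx.symm]
    · simp

theorem exists_dirichlet_eigenfunction {S : Type u} [Fintype S] [DecidableEq S] {P : Matrix S S ℝ}
    {A : Finset S} {μ : ℝ} (hμ : Module.End.HasEigenvalue
      (Matrix.toLin' (P.submatrix (fun x : A => (x : S)) (fun x : A => (x : S)))) μ) :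
    ∃ f : S → ℝ, f ≠ 0 ∧ (∀ x ∉ A, f x = 0) ∧ ∀ x ∈ A, ∑ y, P x y * f y = μ * f x := by
  obtain ⟨g, hg⟩ := hμ.exists_hasEigenvector
  have hgv := hg.apply_eq_smul
  refine ⟨fun x => if h : x ∈ A then g ⟨x, h⟩ else 0, ?_, ?_, ?_⟩
  · intro h0
    refine hg.2 (funext fun x => ?_)
    have := congrFun h0 x.1
    simpa using this
  · intro x hx
    simp [hx]
  · intro x hx
    have h1 := congrFun hgv ⟨x, hx⟩
    simp only [Matrix.toLin'_apply, Matrix.mulVec, dotProduct, Matrix.submatrix_apply,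
      Pi.smul_apply, smul_eq_mul] at h1
    simp only [hx, dif_pos]
    rw [← h1, ← Finset.sum_subset (Finset.subset_univ A)]
    · rw [← Finset.sum_coe_sort A]
      refine Finset.sum_congr rfl fun y _ => ?_
      simp
    · intro y _ hy
      simp [hy]

/-- Pairing the eigenvalue equation with `f` turns the energy into `4 (1 - μ) ∑ f²`; the factor `4`
combines laziness with each edge being counted from both of its half-edges. Passing to `|f|` does
not increase the energy, so nonnegative test functions suffice. -/
theorem eigenvalue_le_of_energy_ge {σ : M.H → M.H} (hσ : Function.Involutive σ) {c : ℝ}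
    (hE : ∀ f : M.V → ℝ, (∀ x, 0 ≤ f x) → 2 * ∑ x with f x ≠ 0, M.d x ≤ M.N →
      4 * c * ∑ h, f (M.vertex h) ^ 2 ≤ ∑ h, (f (M.vertex h) - f (M.vertex (σ h))) ^ 2)
    {A : Finset M.V} (hA : 2 * ∑ x ∈ A, M.d x ≤ M.N) {μ : ℝ} (hμ : Module.End.HasEigenvalue
      (Matrix.toLin' ((lazyWalk σ).submatrix (fun x : A => (x : M.V)) (fun x : A => (x : M.V)))) μ) :
    μ ≤ 1 - c := by
  obtain ⟨f, hf0, hfA, hf⟩ := exists_dirichlet_eigenfunction hμ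
  have h1 := sum_mul_lazyWalk σ f
  have h2 : ∑ x, M.d x * (f x * ∑ y, lazyWalk σ x y * f y) = μ * ∑ h, f (M.vertex h) ^ 2 := by
    rw [sum_halfEdge (fun x => f x ^ 2), Finset.mul_sum]
    refine Finset.sum_congr rfl fun x _ => ?_
    by_cases hx : x ∈ A
    · rw [hf x hx]; ring
    · simp [hfA x hx]
  have h3 : ∑ h, f (M.vertex (σ h)) ^ 2 = ∑ h, f (M.vertex h) ^ 2 :=
    Fintype.sum_bijective σ hσ.bijective _ _ fun h => rfl
  have h4 : ∑ h, (f (M.vertex h) - f (M.vertex (σ h))) ^ 2 =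
      4 * (1 - μ) * ∑ h, f (M.vertex h) ^ 2 := by
    simp_rw [sub_sq, Finset.sum_add_distrib, Finset.sum_sub_distrib, mul_assoc, ← Finset.mul_sum]
    linarith
  have h5 := hE (fun x => |f x|) (fun x => abs_nonneg _) (by
    refine le_trans (Nat.mul_le_mul_left 2 (Finset.sum_le_sum_of_subset fun x hx => ?_)) hA
    by_contra hc
    simp [hfA x hc] at hx)
  have h6 : ∑ h, (|f (M.vertex h)| - |f (M.vertex (σ h))|) ^ 2 ≤
      ∑ h, (f (M.vertex h) - f (M.vertex (σ h))) ^ 2 := by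
    refine Finset.sum_le_sum fun h _ => ?_
    exact sq_le_sq.2 (abs_abs_sub_abs_le_abs_sub (f (M.vertex h)) (f (M.vertex (σ h))))
  simp only [sq_abs] at h5 h6
  have hpos : 0 < ∑ h, f (M.vertex h) ^ 2 := by
    rw [sum_halfEdge (fun x => f x ^ 2)]
    obtain ⟨x, hx⟩ := Function.ne_iff.1 hf0
    refine Finset.sum_pos' (fun y _ => by positivity) ⟨x, Finset.mem_univ x, ?_⟩
    have hx' : f x ≠ 0 := hx
    have hd : (0 : ℝ) < M.d x := by exact_mod_cast (by have := two_le_d x; omega : 0 < M.d x)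
    positivity
  have h7 : 4 * c * ∑ h, f (M.vertex h) ^ 2 ≤ 4 * (1 - μ) * ∑ h, f (M.vertex h) ^ 2 := by
    rw [← h4]; exact h5.trans h6
  have := le_of_mul_le_mul_right h7 hpos
  linarith

/-- Guarantees that the infimum in the spectral profile runs over a nonempty family. A vertex of
minimal degree has at most a share `1 / n` of the volume. -/
theorem exists_small_singleton (hn : 2 ≤ M.n) :
    ∃ x : M.V, (⨅ y, M.stationary y) ≤ M.stationary x ∧ M.stationary x ≤ 1 / 2 := by
  have : Nonempty M.V := Fintype.card_pos_iff.1 (by unfold n at hn; omega)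
  obtain ⟨x, hx⟩ := Finite.exists_min M.d
  refine ⟨x, ciInf_le (Set.finite_range _).bddBelow x, ?_⟩
  have h1 : M.n * M.d x ≤ M.N := by
    rw [← sum_d, n, ← smul_eq_mul, ← Finset.card_univ]
    exact Finset.card_nsmul_le_sum _ _ _ fun y _ => hx y
  have h2 : 2 * M.d x ≤ M.N := le_trans (Nat.mul_le_mul_right _ hn) h1
  have hN : (0 : ℝ) < M.N := by exact_mod_cast N_pos
  unfold stationary
  rw [div_le_div_iff₀ hN (by norm_num)]
  have : (2 : ℝ) * M.d x ≤ M.N := by exact_mod_cast h2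
  linarith

theorem le_spectralProfile_of_energy_ge {σ : M.H → M.H} (hσ : Function.Involutive σ)
    (hn : 2 ≤ M.n) {c : ℝ} (hc : c ≤ 1)
    (hE : ∀ f : M.V → ℝ, (∀ x, 0 ≤ f x) → 2 * ∑ x with f x ≠ 0, M.d x ≤ M.N →
      4 * c * ∑ h, f (M.vertex h) ^ 2 ≤ ∑ h, (f (M.vertex h) - f (M.vertex (σ h))) ^ 2) :
    c ≤ spectralProfile (lazyWalk σ) M.stationary (1 / 2) := by
  refine le_csInf ?_ ?_
  · obtain ⟨x, h1, h2⟩ := exists_small_singleton hn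
    exact ⟨_, {x}, by simpa using ⟨h1, by simpa using h2⟩, rfl⟩
  · rintro _ ⟨A, ⟨-, hA⟩, rfl⟩
    have hN : (0 : ℝ) < M.N := by exact_mod_cast N_pos
    have hA' : 2 * ∑ x ∈ A, M.d x ≤ M.N := by
      unfold stationary at hA
      rw [← Finset.sum_div, div_le_div_iff₀ hN (by norm_num)] at hA
      have : ((2 * ∑ x ∈ A, M.d x : ℕ) : ℝ) ≤ (M.N : ℝ) := by push_cast; linarith
      exact_mod_cast this
    unfold dirichletEigenvalue
    rw [le_sub_comm]
    -- The supremum of an empty set of reals is `0`, so the bound `1 - c` must be nonnegative; this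
    -- is the role of `hc`.
    exact Real.sSup_le (fun μ hμ => eigenvalue_le_of_energy_ge hσ hE hA' hμ) (by linarith)

end TwoCommunities

/-! ### Entropy estimates -/

/-- `exp (N H(s / N))`, with `H` the binary entropy. -/
noncomputable def entropyFactor (N s : ℕ) : ℝ := (N : ℝ) ^ N / ((s : ℝ) ^ s * ((N - s : ℕ) : ℝ) ^ (N - s))

theorem nat_pow_self_pos (k : ℕ) : (0 : ℝ) < (k : ℝ) ^ k := by
  rcases Nat.eq_zero_or_pos k with h | h
  · simp [h]
  · positivity

theorem entropyFactor_pos (N s : ℕ) : 0 < entropyFactor N s :=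
  div_pos (nat_pow_self_pos N) (mul_pos (nat_pow_self_pos s) (nat_pow_self_pos (N - s)))

theorem entropyFactor_zero (N : ℕ) : entropyFactor N 0 = 1 := by
  unfold entropyFactor
  simp [(nat_pow_self_pos N).ne']

/-- The value `y = s / (N - s)` minimizes `(1 + y)^N / y^s`, and the minimum is the entropy factor.
-/
theorem entropyFactor_mul_pow {N s : ℕ} (h : s < N) :
    entropyFactor N s * ((s : ℝ) / (N - s)) ^ s = (1 + (s : ℝ) / (N - s)) ^ N := by
  have hNs : (0 : ℝ) < N - s := sub_pos.2 (by exact_mod_cast h)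
  have h1 : 1 + (s : ℝ) / (N - s) = N / (N - s) := by field_simp; ring
  have h2 : ((N : ℝ) - s) ^ N = (N - s) ^ (N - s) * (N - s) ^ s := by
    rw [← pow_add, Nat.sub_add_cancel h.le]
  rw [h1, entropyFactor, Nat.cast_sub h.le, div_pow, div_pow, h2]
  have h3 := (nat_pow_self_pos s).ne'
  field_simp

theorem div_pow_le_entropyFactor {N s : ℕ} (h : s ≤ N) :
    ((N : ℝ) / s) ^ s ≤ entropyFactor N s := by
  have h2 : (N : ℝ) ^ N = N ^ s * N ^ (N - s) := by
    rw [← pow_add, Nat.add_sub_cancel' h]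
  rw [entropyFactor, div_pow, h2, div_le_div_iff₀ (nat_pow_self_pos s)
    (mul_pos (nat_pow_self_pos s) (nat_pow_self_pos _))]
  have h3 : ((N - s : ℕ) : ℝ) ^ (N - s) ≤ N ^ (N - s) := by
    gcongr
    exact Nat.sub_le _ _
  have h4 := nat_pow_self_pos s
  have h5 : (0 : ℝ) ≤ (N : ℝ) ^ s := by positivity
  calc (N : ℝ) ^ s * ((s : ℝ) ^ s * ((N - s : ℕ) : ℝ) ^ (N - s))
      ≤ (N : ℝ) ^ s * ((s : ℝ) ^ s * (N : ℝ) ^ (N - s)) := by gcongr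
    _ = _ := by ring

theorem succ_pow_le_exp_mul (k : ℕ) : ((k : ℝ) + 1) ^ k ≤ Real.exp 1 * (k : ℝ) ^ k := by
  rcases Nat.eq_zero_or_pos k with h | h
  · subst h; simp
  · have hk : (0 : ℝ) < k := by exact_mod_cast h
    have h1 : (1 / (k : ℝ) + 1) ^ k ≤ Real.exp 1 := by
      calc (1 / (k : ℝ) + 1) ^ k ≤ (Real.exp (1 / k)) ^ k := by
            gcongr; exact Real.add_one_le_exp _
        _ = Real.exp 1 := by rw [← Real.exp_nat_mul]; congr 1; field_simp
    have h2 : (k : ℝ) + 1 = k * (1 / k + 1) := by field_simp; ring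
    rw [h2, mul_pow, mul_comm]
    gcongr

theorem exp_mul_pow_succ_le (k : ℕ) : Real.exp 1 * (k : ℝ) ^ (k + 1) ≤ ((k : ℝ) + 1) ^ (k + 1) := by
  have hk : (0 : ℝ) < k + 1 := by positivity
  have h1 : (k / ((k : ℝ) + 1)) ^ (k + 1) ≤ Real.exp (-1) := by
    calc (k / ((k : ℝ) + 1)) ^ (k + 1) ≤ (Real.exp (-(1 / ((k : ℝ) + 1)))) ^ (k + 1) := by
          gcongr
          have := Real.add_one_le_exp (-(1 / ((k : ℝ) + 1)))
          refine le_trans (le_of_eq ?_) this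
          field_simp
          ring
      _ = Real.exp (-1) := by rw [← Real.exp_nat_mul]; congr 1; push_cast; field_simp
  rw [div_pow, div_le_iff₀ (by positivity), Real.exp_neg] at h1
  have he := Real.exp_pos 1
  calc Real.exp 1 * (k : ℝ) ^ (k + 1) ≤ Real.exp 1 * ((Real.exp 1)⁻¹ * ((k : ℝ) + 1) ^ (k + 1)) := by
        gcongr
    _ = _ := by field_simp

/-- Stirling-type bound without Stirling: the induction step on `s` reduces to `(1 + 1/k)^k ≤ e ≤ (1
+ 1/s)^(s+1)`. -/
theorem pow_self_le_mul_choose {N s : ℕ} (hs : 1 ≤ s) (h : s ≤ N) :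
    (N : ℝ) ^ N ≤ Real.exp 1 * s * N.choose s * ((s : ℝ) ^ s * ((N - s : ℕ) : ℝ) ^ (N - s)) := by
  induction s, hs using Nat.le_induction with
  | base =>
    obtain ⟨k, rfl⟩ : ∃ k, N = k + 1 := ⟨N - 1, by omega⟩
    have := succ_pow_le_exp_mul k
    simp only [Nat.cast_one, Nat.choose_one_right, Nat.add_sub_cancel, one_pow, one_mul, mul_one]
    push_cast
    rw [pow_succ]
    nlinarith [(by positivity : (0 : ℝ) ≤ k)]
  | succ s hs ih =>
    refine (ih (by omega)).trans ?_
    obtain ⟨k, rfl⟩ : ∃ k, N = s + (k + 1) := ⟨N - s - 1, by omega⟩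
    have e1 : s + (k + 1) - s = k + 1 := by omega
    have e2 : s + (k + 1) - (s + 1) = k := by omega
    have e3 : ((s + (k + 1)).choose (s + 1) : ℝ) * (s + 1) = (s + (k + 1)).choose s * (k + 1) := by
      have := Nat.choose_succ_right_eq (s + (k + 1)) s
      rw [e1] at this
      exact_mod_cast this
    have h1 := succ_pow_le_exp_mul k
    have h2 := exp_mul_pow_succ_le s
    have key : (s : ℝ) ^ (s + 1) * ((k : ℝ) + 1) ^ k ≤ ((s : ℝ) + 1) ^ (s + 1) * (k : ℝ) ^ k := by
      calc (s : ℝ) ^ (s + 1) * ((k : ℝ) + 1) ^ k ≤ (s : ℝ) ^ (s + 1) * (Real.exp 1 * (k : ℝ) ^ k) := by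
            gcongr
        _ = (Real.exp 1 * (s : ℝ) ^ (s + 1)) * (k : ℝ) ^ k := by ring
        _ ≤ _ := by gcongr
    rw [e1, e2]
    push_cast
    have hC : (0 : ℝ) ≤ Real.exp 1 * ((s + (k + 1)).choose s * (k + 1)) := by positivity
    calc _ = Real.exp 1 * ((s + (k + 1)).choose s * (k + 1)) *
          ((s : ℝ) ^ (s + 1) * ((k : ℝ) + 1) ^ k) := by ring
      _ ≤ Real.exp 1 * ((s + (k + 1)).choose s * (k + 1)) *
          (((s : ℝ) + 1) ^ (s + 1) * (k : ℝ) ^ k) := by gcongr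
      _ = _ := by rw [← e3]; ring

theorem entropyFactor_le_mul_choose {N s : ℕ} (h : s ≤ N) :
    entropyFactor N s ≤ Real.exp 1 * (s + 1) * N.choose s := by
  rcases Nat.eq_zero_or_pos s with h0 | h0
  · subst h0
    rw [entropyFactor_zero]
    simp
  · rw [entropyFactor, div_le_iff₀ (mul_pos (nat_pow_self_pos s) (nat_pow_self_pos _))]
    refine (pow_self_le_mul_choose h0 h).trans ?_
    gcongr
    linarith

/-- Monotonicity of `ℓ^p` norms: the `ℓ^d` norm of `(1, u)` is at most its `ℓ^3` norm. -/
theorem one_add_pow_le_rpow {u : ℝ} (hu : 0 ≤ u) {d : ℕ} (hd : 3 ≤ d) :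
    1 + u ^ d ≤ (1 + u ^ 3) ^ ((d : ℝ) / 3) := by
  have hd' : (3 : ℝ) ≤ d := by exact_mod_cast hd
  lift u to NNReal using hu
  have h1 : (1 + (u : ℝ) ^ d) ^ (1 / (d : ℝ)) ≤ (1 + (u : ℝ) ^ 3) ^ (1 / 3 : ℝ) := by
    have h := NNReal.rpow_add_rpow_le (p := (3 : ℕ)) (q := d) 1 u (by norm_num) (by exact_mod_cast hd)
    simp only [NNReal.rpow_natCast, one_pow] at h
    exact_mod_cast NNReal.coe_le_coe.2 h
  have h2 := Real.rpow_le_rpow (by positivity) h1 (by positivity : (0 : ℝ) ≤ d)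
  rw [← Real.rpow_mul (by positivity), ← Real.rpow_mul (by positivity)] at h2
  have e1 : 1 / (d : ℝ) * d = 1 := by field_simp
  have e2 : 1 / 3 * (d : ℝ) = d / 3 := by ring
  rwa [e1, e2, Real.rpow_one] at h2

/-- The number of vertex sets of given volume, when all degrees are at least three. -/
theorem card_volume_eq_le {V : Type*} [Fintype V] [DecidableEq V] (d : V → ℕ) (hd : ∀ v, 3 ≤ d v)
    {s : ℕ} (hs : s < ∑ v, d v) :
    (((Finset.univ : Finset (Finset V)).filter fun B => ∑ v ∈ B, d v = s).card : ℝ) ≤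
      entropyFactor (∑ v, d v) s ^ (1 / 3 : ℝ) := by
  set N := ∑ v, d v with hN
  set y : ℝ := (s : ℝ) / (N - s) with hy
  have hNs : (0 : ℝ) < N - s := sub_pos.2 (by exact_mod_cast hs)
  have hy0 : 0 ≤ y := by positivity
  set u : ℝ := y ^ (1 / 3 : ℝ) with hu
  have hu0 : 0 ≤ u := by positivity
  have hu3 : u ^ 3 = y := by
    rw [hu, ← Real.rpow_natCast, ← Real.rpow_mul hy0]; norm_num
  have hus : u ^ s = (y ^ s) ^ (1 / 3 : ℝ) := by
    rw [hu, ← Real.rpow_natCast, ← Real.rpow_natCast, ← Real.rpow_mul hy0, ← Real.rpow_mul hy0,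
      mul_comm]
  have hupos : 0 < u ^ s := by
    rcases Nat.eq_zero_or_pos s with h | h
    · simp [h]
    · have : (0 : ℝ) < s := by exact_mod_cast h
      positivity
  refine le_of_mul_le_mul_right ?_ hupos
  -- Chernoff counting with weight `u` per unit of volume. Degrees at least three allow `1 + u^d` to
  -- be replaced by `(1 + u³)^(d/3)`, and `u³ = y` is the saddle point.
  calc _ = ∑ B with ∑ v ∈ B, d v = s, u ^ (∑ v ∈ B, d v) := by
        rw [Finset.sum_congr rfl fun B hB => by rw [(Finset.mem_filter.1 hB).2]]
        simp
    _ ≤ ∑ B : Finset V, u ^ (∑ v ∈ B, d v) :=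
        Finset.sum_le_sum_of_subset_of_nonneg (Finset.filter_subset _ _) fun _ _ _ => by positivity
    _ = ∏ v, (1 + u ^ d v) := by
        rw [Finset.prod_one_add, Finset.powerset_univ]
        exact Finset.sum_congr rfl fun B _ => (Finset.prod_pow_eq_pow_sum _ _ _).symm
    _ ≤ ∏ v, (1 + y) ^ ((d v : ℝ) / 3) := by
        refine Finset.prod_le_prod (fun v _ => by positivity) fun v _ => ?_
        rw [← hu3]
        exact one_add_pow_le_rpow hu0 (hd v)
    _ = (entropyFactor N s * y ^ s) ^ (1 / 3 : ℝ) := by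
        rw [entropyFactor_mul_pow hs, ← Real.rpow_sum_of_pos (by positivity), ← Finset.sum_div,
          ← Nat.cast_sum, ← hN, ← Real.rpow_natCast, ← Real.rpow_mul (by positivity)]
        congr 1
        ring
    _ = _ := by
        rw [hus, Real.mul_rpow (entropyFactor_pos _ _).le (by positivity)]

/-! ### The generating function of cuts of a pairing -/

theorem one_add_mul_le_sqrt_mul_sqrt (a b : ℝ) :
    1 + a * b ≤ √(1 + a ^ 2) * √(1 + b ^ 2) := by
  rw [← Real.sqrt_mul (by positivity)]
  exact Real.le_sqrt_of_sq_le (by nlinarith [sq_nonneg (a - b)])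

theorem add_le_sqrt_mul_sqrt (a b : ℝ) :
    a + b ≤ √(1 + a ^ 2) * √(1 + b ^ 2) := by
  rw [← Real.sqrt_mul (by positivity)]
  exact Real.le_sqrt_of_sq_le (by nlinarith [sq_nonneg (a * b - 1)])

theorem one_le_sqrt_mul_sqrt (a b : ℝ) :
    1 ≤ √(1 + a ^ 2) * √(1 + b ^ 2) := by
  rw [← Real.sqrt_mul (by positivity)]
  exact Real.le_sqrt_of_sq_le (by nlinarith [sq_nonneg (a * b), sq_nonneg a, sq_nonneg b])

/-- One edge has four configurations. A cut edge costs `z²`, one `z` per half-edge. Untwisted the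
sum is `1 + ab + z²(a + b)`, twisted it is `z²(1 + ab) + (a + b)`; Cauchy–Schwarz extracts the
square roots in both cases. -/
theorem edge_sum_le {a b z : ℝ} (ha : 0 ≤ a) (hb : 0 ≤ b) (t : Bool) :
    ∑ c : Bool → Bool, ∏ i : Bool, ((if c i then (if i then b else a) else 1) *
      (if (c i ^^ c (!i) ^^ t) then z else 1)) ≤
    (√(1 + a ^ 2) * Real.exp (z ^ 2 * (a + if t then 1 / 2 else 0))) *
      (√(1 + b ^ 2) * Real.exp (z ^ 2 * (b + if t then 1 / 2 else 0))) := by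
  have h0 := one_le_sqrt_mul_sqrt a b
  have h1 := one_add_mul_le_sqrt_mul_sqrt a b
  have h2 := add_le_sqrt_mul_sqrt a b
  have hz := sq_nonneg z
  rw [mul_mul_mul_comm, ← Real.exp_add]
  set Q := √(1 + a ^ 2) * √(1 + b ^ 2)
  rw [← (Equiv.boolArrowEquivProd Bool).symm.sum_comp, Fintype.sum_prod_type]
  have hexp := fun y : ℝ => mul_le_mul_of_nonneg_left (Real.add_one_le_exp y) (zero_le_one.trans h0)
  cases t
  · refine le_trans ?_ (hexp _)
    simp [Equiv.boolArrowEquivProd]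
    have := mul_le_mul_of_nonneg_right h0 (mul_nonneg hz (add_nonneg ha hb))
    nlinarith
  · refine le_trans ?_ (hexp _)
    simp [Equiv.boolArrowEquivProd]
    have := mul_le_mul_of_nonneg_right h1 hz
    have := mul_nonneg (zero_le_one.trans h0) (mul_nonneg hz (add_nonneg ha hb))
    nlinarith

theorem exists_transversal_equiv {H : Type*} [Fintype H] [DecidableEq H] {σ : H → H}
    (hσ : Function.Involutive σ) (hfix : ∀ h, σ h ≠ h) :
    ∃ (R : Finset H) (e : R × Bool ≃ H), (∀ r, e (r, false) = r) ∧ ∀ r i, e (r, !i) = σ (e (r, i)) := by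
  set g := Fintype.equivFin H
  -- One representative per edge: the half-edge with the smaller label.
  set R : Finset H := Finset.univ.filter fun h => g h < g (σ h) with hR
  have hmem : ∀ h, h ∈ R ↔ g h < g (σ h) := fun h => by simp [hR]
  have hmem' : ∀ h, σ h ∈ R ↔ ¬ h ∈ R := fun h => by
    rw [hmem, hmem, hσ h, not_lt]
    exact ⟨le_of_lt, fun hle => lt_of_le_of_ne hle fun he => hfix h (g.injective he)⟩
  set F : R × Bool → H := fun x => if x.2 then σ x.1 else x.1 with hF
  have hbij : Function.Bijective F := by
    constructor
    · rintro ⟨⟨r, hr⟩, i⟩ ⟨⟨r', hr'⟩, i'⟩ h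
      cases i <;> cases i' <;> simp [hF] at h ⊢
      · exact h
      · exact (hmem' r').1 (h ▸ hr) hr'
      · exact (hmem' r).1 (h ▸ hr') hr
      · exact hσ.injective h
    · intro h
      by_cases hh : h ∈ R
      · exact ⟨(⟨h, hh⟩, false), by simp [hF]⟩
      · exact ⟨(⟨σ h, (hmem' h).2 hh⟩, true), by simp [hF, hσ h]⟩
  refine ⟨R, Equiv.ofBijective F hbij, fun r => by simp [hF], fun r i => ?_⟩
  cases i <;> simp [hF, hσ _]

/-- Generating function of the sizes of the sets `s` of half-edges and of their (twisted) edge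
boundaries with respect to a pairing `σ`. -/
theorem sum_prod_cut_le {H : Type*} [Fintype H] [DecidableEq H] {σ : H → H}
    (hσ : Function.Involutive σ) (hfix : ∀ h, σ h ≠ h) {w : H → ℝ} (hw : ∀ h, 0 ≤ w h)
    {tw : H → Bool} (htw : ∀ h, tw (σ h) = tw h) {z : ℝ} (hz : 0 ≤ z) :
    ∑ s : H → Bool, ∏ h, ((if s h then w h else 1) * (if (s h ^^ s (σ h) ^^ tw h) then z else 1)) ≤
      ∏ h, (√(1 + w h ^ 2) * Real.exp (z ^ 2 * (w h + if tw h then 1 / 2 else 0))) := by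
  obtain ⟨R, e, he0, heσ⟩ := exists_transversal_equiv hσ hfix
  have he1 : ∀ r, e (r, true) = σ r := fun r => by rw [← he0 r, ← heσ r false]; rfl
  rw [← e.prod_comp, Fintype.prod_prod_type]
  have hL : ∀ s : H → Bool, ∏ h, ((if s h then w h else 1) *
      (if (s h ^^ s (σ h) ^^ tw h) then z else 1)) = ∏ r : R, ∏ i : Bool,
        ((if s (e (r, i)) then (if i then w (σ r) else w r) else 1) *
          (if (s (e (r, i)) ^^ s (e (r, !i)) ^^ tw r) then z else 1)) := by
    intro s
    rw [← e.prod_comp, Fintype.prod_prod_type]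
    refine Finset.prod_congr rfl fun r _ => Finset.prod_congr rfl fun i _ => ?_
    rw [heσ]
    cases i
    · simp [he0]
    · simp [he1, htw]
  simp_rw [hL]
  -- The two half-edges of an edge only interact with each other, so the sum over all sets is a
  -- product of sums over single edges.
  have hsum : ∑ s : H → Bool, ∏ r : R, ∏ i : Bool,
        ((if s (e (r, i)) then (if i then w (σ r) else w r) else 1) *
          (if (s (e (r, i)) ^^ s (e (r, !i)) ^^ tw r) then z else 1)) =
      ∏ r : R, ∑ c : Bool → Bool, ∏ i : Bool, ((if c i then (if i then w (σ r) else w r) else 1) *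
          (if (c i ^^ c (!i) ^^ tw r) then z else 1)) := by
    rw [Finset.prod_univ_sum, Fintype.piFinset_univ]
    refine Fintype.sum_equiv ((e.symm.arrowCongr (Equiv.refl Bool)).trans
      (Equiv.curry R Bool Bool)) _ _ fun s => ?_
    rfl
  rw [hsum]
  refine Finset.prod_le_prod (fun r _ => ?_) fun r _ => ?_
  · refine Finset.sum_nonneg fun c _ => Finset.prod_nonneg fun i _ => mul_nonneg ?_ ?_
    · split_ifs
      exacts [hw _, hw _, zero_le_one]
    · split_ifs
      exacts [hz, zero_le_one]
  · refine (edge_sum_le (hw _) (hw _) _).trans (le_of_eq ?_)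
    simp [he0, he1, htw, mul_comm]

/-! ### Invariance and support of the law of the pairing -/

theorem PMF.uniformOfFintype_bind_equiv {X Y Z : Type*} [Fintype X] [Nonempty X] [Fintype Y]
    [Nonempty Y] (e : X ≃ Y) (g : Y → PMF Z) :
    ((PMF.uniformOfFintype X).bind fun x => g (e x)) = (PMF.uniformOfFintype Y).bind g := by
  ext z
  simp only [PMF.bind_apply, PMF.uniformOfFintype_apply, Fintype.card_congr e]
  exact e.tsum_eq fun y => ((Fintype.card Y : ℝ≥0∞))⁻¹ * g y z

/-- Transport of perfect matchings along a bijection. -/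
def PerfectMatching.congr {X Y : Type*} (k : X ≃ Y) : PerfectMatching X ≃ PerfectMatching Y :=
  (k.arrowCongr k).subtypeEquiv fun m => by
    constructor
    · intro h y
      have := h (k.symm y)
      simp only [Equiv.arrowCongr_apply, Function.comp_apply, Equiv.symm_apply_apply, this.1,
        Equiv.apply_symm_apply, true_and]
      intro hy
      exact this.2 (by rw [Equiv.eq_symm_apply]; exact hy)
    · intro h x
      have := h (k x)
      simpa using this

theorem PerfectMatching.congr_apply {X Y : Type*} (k : X ≃ Y) (m : PerfectMatching X) (x : X) :
    (PerfectMatching.congr k m).1 (k x) = k (m.1 x) := by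
  simp [PerfectMatching.congr]

namespace TwoCommunities

variable {M : TwoCommunities.{u}}

/-- The action of a permutation on the sets of outgoing half-edges. -/
def outgoingCongr {X : Type*} (τ : Equiv.Perm X) (p : ℕ) :
    {O : Finset X // O.card = p} ≃ {O : Finset X // O.card = p} :=
  (Equiv.finsetCongr τ).subtypeEquiv fun O => by simp

theorem mem_outgoingCongr {X : Type*} (τ : Equiv.Perm X) {p : ℕ}
    (O : {O : Finset X // O.card = p}) (h : X) : τ h ∈ (outgoingCongr τ p O).1 ↔ h ∈ O.1 := by
  simp [outgoingCongr]

/-- The outgoing half-edges before and after a permutation. -/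
def memCongr {X : Type*} (τ : Equiv.Perm X) {p : ℕ} (O : {O : Finset X // O.card = p}) :
    O.1 ≃ (outgoingCongr τ p O).1 :=
  τ.subtypeEquiv fun h => (mem_outgoingCongr τ O h).symm

/-- The internal half-edges before and after a permutation. -/
def notMemCongr {X : Type*} (τ : Equiv.Perm X) {p : ℕ} (O : {O : Finset X // O.card = p}) :
    {h : X // h ∉ O.1} ≃ {h : X // h ∉ (outgoingCongr τ p O).1} :=
  τ.subtypeEquiv fun h => (mem_outgoingCongr τ O h).symm.not

/-- Conjugation of a pairing by permutations of the half-edges within the communities. -/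
def conj (τ₁ : Equiv.Perm M.H₁) (τ₂ : Equiv.Perm M.H₂) (σ : M.H → M.H) : M.H → M.H :=
  fun h => Equiv.sumCongr τ₁ τ₂ (σ ((Equiv.sumCongr τ₁ τ₂).symm h))

theorem conj_pairing (τ₁ : Equiv.Perm M.H₁) (τ₂ : Equiv.Perm M.H₂) (O₁ : M.Outgoing₁)
    (O₂ : M.Outgoing₂) (b : O₁.1 ≃ O₂.1) (m₁ : PerfectMatching (Internal₁ O₁))
    (m₂ : PerfectMatching (Internal₂ O₂)) :
    conj τ₁ τ₂ (pairing O₁ O₂ b m₁ m₂) =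
      pairing (outgoingCongr τ₁ M.p O₁) (outgoingCongr τ₂ M.p O₂)
        (Equiv.equivCongr (memCongr τ₁ O₁) (memCongr τ₂ O₂) b)
        (PerfectMatching.congr (notMemCongr τ₁ O₁) m₁)
        (PerfectMatching.congr (notMemCongr τ₂ O₂) m₂) := by
  funext h
  obtain ⟨h, rfl⟩ := (Equiv.sumCongr τ₁ τ₂).surjective h
  simp only [conj, Equiv.symm_apply_apply]
  rcases h with h | h
  · by_cases hh : h ∈ O₁.1
    · have h2 := (mem_outgoingCongr τ₁ O₁ h).2 hh
      have h3 : (memCongr τ₁ O₁).symm ⟨τ₁ h, h2⟩ = ⟨h, hh⟩ := by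
        rw [Equiv.symm_apply_eq]; rfl
      simp [pairing, hh, h2, h3, Equiv.equivCongr]
      rfl
    · have h2 := (mem_outgoingCongr τ₁ O₁ h).not.2 hh
      have h3 := PerfectMatching.congr_apply (notMemCongr τ₁ O₁) m₁ ⟨h, hh⟩
      have h4 : notMemCongr τ₁ O₁ ⟨h, hh⟩ = ⟨τ₁ h, h2⟩ := rfl
      rw [h4] at h3
      simp [pairing, hh, h2, h3]
      rfl
  · by_cases hh : h ∈ O₂.1
    · have h2 := (mem_outgoingCongr τ₂ O₂ h).2 hh
      have h3 : (memCongr τ₂ O₂).symm ⟨τ₂ h, h2⟩ = ⟨h, hh⟩ := by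
        rw [Equiv.symm_apply_eq]; rfl
      simp [pairing, hh, h2, h3, Equiv.equivCongr]
      rfl
    · have h2 := (mem_outgoingCongr τ₂ O₂ h).not.2 hh
      have h3 := PerfectMatching.congr_apply (notMemCongr τ₂ O₂) m₂ ⟨h, hh⟩
      have h4 : notMemCongr τ₂ O₂ ⟨h, hh⟩ = ⟨τ₂ h, h2⟩ := rfl
      rw [h4] at h3
      simp [pairing, hh, h2, h3]
      rfl

/-- Every stage of the construction is uniform, and the permutations carry the choices at each stage
bijectively to the choices for the relabelled outgoing sets. -/
theorem map_conj_law (τ₁ : Equiv.Perm M.H₁) (τ₂ : Equiv.Perm M.H₂) :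
    M.law.map (conj τ₁ τ₂) = M.law := by
  conv_rhs => rw [law]
  rw [law, PMF.map_bind]
  refine Eq.trans ?_ (PMF.uniformOfFintype_bind_equiv (outgoingCongr τ₁ M.p) _)
  congr 1; funext O₁
  rw [PMF.map_bind]
  refine Eq.trans ?_ (PMF.uniformOfFintype_bind_equiv (outgoingCongr τ₂ M.p) _)
  congr 1; funext O₂
  rw [PMF.map_bind]
  refine Eq.trans ?_ (PMF.uniformOfFintype_bind_equiv
    (Equiv.equivCongr (memCongr τ₁ O₁) (memCongr τ₂ O₂)) _)
  congr 1; funext b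
  rw [PMF.map_bind]
  refine Eq.trans ?_ (PMF.uniformOfFintype_bind_equiv
    (PerfectMatching.congr (notMemCongr τ₁ O₁)) _)
  congr 1; funext m₁
  rw [PMF.map_comp]
  unfold PMF.map
  refine Eq.trans ?_ (PMF.uniformOfFintype_bind_equiv
    (PerfectMatching.congr (notMemCongr τ₂ O₂)) _)
  congr 1; funext m₂
  simp only [Function.comp_apply, conj_pairing]

theorem conj_injective (τ₁ : Equiv.Perm M.H₁) (τ₂ : Equiv.Perm M.H₂) :
    Function.Injective (conj (M := M) τ₁ τ₂) := by
  intro σ σ' h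
  funext x
  have := congrFun h (Equiv.sumCongr τ₁ τ₂ x)
  simp only [conj, Equiv.symm_apply_apply] at this
  exact (Equiv.sumCongr τ₁ τ₂).injective this

theorem law_conj (τ₁ : Equiv.Perm M.H₁) (τ₂ : Equiv.Perm M.H₂) (σ : M.H → M.H) :
    M.law (conj τ₁ τ₂ σ) = M.law σ := by
  conv_lhs => rw [← map_conj_law τ₁ τ₂, PMF.map_apply]
  rw [tsum_eq_single σ]
  · simp
  · intro σ' hσ'
    rw [if_neg fun h => hσ' (conj_injective τ₁ τ₂ h).symm]

/-- Whether the partner of a half-edge lies in the other community. -/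
def crosses (σ : M.H → M.H) (h : M.H) : Bool := h.isLeft ^^ (σ h).isLeft

/-- The properties of the pairings in the support of the law. -/
structure IsPairing (σ : M.H → M.H) : Prop where
  involutive : Function.Involutive σ
  ne_self : ∀ h, σ h ≠ h
  card_crosses₁ : (Finset.univ.filter fun h : M.H₁ => crosses σ (Sum.inl h) = true).card = M.p
  card_crosses₂ : (Finset.univ.filter fun h : M.H₂ => crosses σ (Sum.inr h) = true).card = M.p

theorem isPairing_pairing (O₁ : M.Outgoing₁)
    (O₂ : M.Outgoing₂) (b : O₁.1 ≃ O₂.1) (m₁ : PerfectMatching (Internal₁ O₁))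
    (m₂ : PerfectMatching (Internal₂ O₂)) : IsPairing (pairing O₁ O₂ b m₁ m₂) := by
  refine ⟨?_, ?_, ?_, ?_⟩
  · rintro (h | h)
    · by_cases hh : h ∈ O₁.1
      · simp [pairing, hh]
      · simp [pairing, hh, (m₁.1 ⟨h, hh⟩).2, (m₁.2 _).1]
    · by_cases hh : h ∈ O₂.1
      · simp [pairing, hh]
      · simp [pairing, hh, (m₂.1 ⟨h, hh⟩).2, (m₂.2 _).1]
  · rintro (h | h)
    · by_cases hh : h ∈ O₁.1
      · simp [pairing, hh]
      · have := (m₁.2 ⟨h, hh⟩).2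
        simpa [pairing, hh, Subtype.ext_iff] using this
    · by_cases hh : h ∈ O₂.1
      · simp [pairing, hh]
      · have := (m₂.2 ⟨h, hh⟩).2
        simpa [pairing, hh, Subtype.ext_iff] using this
  · rw [← O₁.2]
    congr 1
    ext h
    by_cases hh : h ∈ O₁.1 <;> simp [crosses, pairing, hh]
  · rw [← O₂.2]
    congr 1
    ext h
    by_cases hh : h ∈ O₂.1 <;> simp [crosses, pairing, hh]

theorem isPairing_of_law_ne_zero {σ : M.H → M.H} (h : M.law σ ≠ 0) : IsPairing σ := by
  have h' : σ ∈ M.law.support := h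
  simp only [law, PMF.mem_support_bind_iff, PMF.mem_support_map_iff] at h'
  obtain ⟨O₁, -, O₂, -, b, -, m₁, -, m₂, -, rfl⟩ := h'
  exact isPairing_pairing O₁ O₂ b m₁ m₂

/-- The probability of a pairing, as a real number. -/
noncomputable def weight (σ : M.H → M.H) : ℝ := (M.law σ).toReal

theorem weight_nonneg (σ : M.H → M.H) : 0 ≤ weight σ := ENNReal.toReal_nonneg

theorem weight_conj (τ₁ : Equiv.Perm M.H₁) (τ₂ : Equiv.Perm M.H₂) (σ : M.H → M.H) :
    weight (conj τ₁ τ₂ σ) = weight σ := by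
  rw [weight, law_conj, weight]

theorem isPairing_of_weight_ne_zero {σ : M.H → M.H} (h : weight σ ≠ 0) : IsPairing σ :=
  isPairing_of_law_ne_zero fun h0 => h (by simp [weight, h0])

theorem toOuterMeasure_law_toReal (s : Set (M.H → M.H)) [DecidablePred (· ∈ s)] :
    (M.law.toOuterMeasure s).toReal = ∑ σ with σ ∈ s, weight σ := by
  rw [PMF.toOuterMeasure_apply_fintype, ENNReal.toReal_sum]
  · rw [Finset.sum_filter]
    refine Finset.sum_congr rfl fun σ _ => ?_
    by_cases h : σ ∈ s <;> simp [Set.indicator, h, weight]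
  · intro σ _
    by_cases h : σ ∈ s <;> simp [Set.indicator, h, PMF.apply_ne_top]

theorem sum_weight : ∑ σ : M.H → M.H, weight σ = 1 := by
  have h := toOuterMeasure_law_toReal (M := M) Set.univ
  have h1 : M.law.toOuterMeasure Set.univ = 1 := by
    rw [PMF.toOuterMeasure_apply_eq_one_iff]; exact Set.subset_univ _
  rw [h1] at h
  simpa using h.symm

end TwoCommunities

/-! ### The moment generating function of the cut size -/

theorem Finset.exists_perm_mem_iff {X : Type*} [Fintype X] [DecidableEq X] {S S' : Finset X}
    (h : S.card = S'.card) : ∃ τ : Equiv.Perm X, ∀ x, τ x ∈ S' ↔ x ∈ S := by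
  let e : {x // x ∈ S} ≃ {x // x ∈ S'} := Finset.equivOfCardEq h
  refine ⟨e.extendSubtype, fun x => ⟨fun hx => ?_, fun hx => e.extendSubtype_mem x hx⟩⟩
  by_contra hc
  exact e.extendSubtype_not_mem x hc hx

theorem sqrt_entropyFactor_mul_pow {N s : ℕ} (h : s < N) :
    √(entropyFactor N s) * √((s : ℝ) / (N - s)) ^ s = √(1 + √((s : ℝ) / (N - s)) ^ 2) ^ N := by
  have hNs : (0 : ℝ) < N - s := sub_pos.2 (by exact_mod_cast h)
  have hy : 0 ≤ (s : ℝ) / (N - s) := by positivity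
  have h1 : ∀ (a : ℝ) (k : ℕ), 0 ≤ a → √a ^ k = √(a ^ k) := fun a k ha => by
    rw [eq_comm, Real.sqrt_eq_iff_mul_self_eq (by positivity) (by positivity), ← mul_pow,
      Real.mul_self_sqrt ha]
  rw [Real.sq_sqrt hy, h1 _ _ hy, h1 _ _ (by positivity), ← Real.sqrt_mul (entropyFactor_pos _ _).le,
    entropyFactor_mul_pow h]

namespace TwoCommunities

variable {M : TwoCommunities.{u}}

/-- The indicator of a set of half-edges given by its parts in the two communities. -/
def indicator (S₁ : Finset M.H₁) (S₂ : Finset M.H₂) : M.H → Bool :=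
  Sum.elim (fun h => decide (h ∈ S₁)) (fun h => decide (h ∈ S₂))

theorem indicator_bijective :
    Function.Bijective fun S : Finset M.H₁ × Finset M.H₂ => indicator S.1 S.2 := by
  constructor
  · rintro ⟨S₁, S₂⟩ ⟨T₁, T₂⟩ h
    have h1 : S₁ = T₁ := by
      ext x
      simpa [indicator] using congrFun h (Sum.inl x)
    have h2 : S₂ = T₂ := by
      ext x
      simpa [indicator] using congrFun h (Sum.inr x)
    rw [h1, h2]
  · intro s
    refine ⟨(Finset.univ.filter fun h => s (Sum.inl h) = true,
      Finset.univ.filter fun h => s (Sum.inr h) = true), ?_⟩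
    funext h
    rcases h with h | h <;> simp [indicator]

/-- The number of half-edges on cut edges; if `t` is set, the edges between the communities are cut
when their end points are both in the set or both outside. -/
def cutSize (t : Bool) (σ : M.H → M.H) (s : M.H → Bool) : ℕ :=
  (Finset.univ.filter fun h => (s h ^^ s (σ h) ^^ (t && crosses σ h)) = true).card

theorem crosses_conj (τ₁ : Equiv.Perm M.H₁) (τ₂ : Equiv.Perm M.H₂) (σ : M.H → M.H) (h : M.H) :
    crosses (conj τ₁ τ₂ σ) (Equiv.sumCongr τ₁ τ₂ h) = crosses σ h := by
  simp only [crosses, conj, Equiv.symm_apply_apply]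
  rcases h with h | h <;> rcases σ _ with h' | h' <;> rfl

theorem crosses_apply {σ : M.H → M.H} (hσ : Function.Involutive σ) (h : M.H) :
    crosses σ (σ h) = crosses σ h := by
  simp only [crosses, hσ h, Bool.xor_comm]

theorem cutSize_conj (t : Bool) (τ₁ : Equiv.Perm M.H₁) (τ₂ : Equiv.Perm M.H₂) (σ : M.H → M.H)
    (s : M.H → Bool) :
    cutSize t (conj τ₁ τ₂ σ) s = cutSize t σ (s ∘ Equiv.sumCongr τ₁ τ₂) := by
  unfold cutSize
  symm
  refine Finset.card_equiv (Equiv.sumCongr τ₁ τ₂) fun h => ?_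
  simp only [Finset.mem_filter, Finset.mem_univ, true_and, crosses_conj, Function.comp_apply]
  simp only [conj, Equiv.symm_apply_apply]

/-- The moment generating function of the cut size. -/
noncomputable def cutGen (M : TwoCommunities.{u}) (t : Bool) (z : ℝ) (s : M.H → Bool) : ℝ :=
  ∑ σ : M.H → M.H, weight σ * z ^ cutSize t σ s

theorem cutGen_comp (t : Bool) (z : ℝ) (τ₁ : Equiv.Perm M.H₁) (τ₂ : Equiv.Perm M.H₂)
    (s : M.H → Bool) : cutGen M t z (s ∘ Equiv.sumCongr τ₁ τ₂) = cutGen M t z s := by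
  unfold cutGen
  refine Fintype.sum_bijective (conj τ₁ τ₂)
    (Finite.injective_iff_bijective.1 (conj_injective τ₁ τ₂)) _ _ fun σ => ?_
  rw [weight_conj, cutSize_conj]

/-- Permutations act transitively on sets of a given size and preserve the law. -/
theorem cutGen_indicator_eq (t : Bool) (z : ℝ) {S₁ T₁ : Finset M.H₁} {S₂ T₂ : Finset M.H₂}
    (h₁ : S₁.card = T₁.card) (h₂ : S₂.card = T₂.card) :
    cutGen M t z (indicator S₁ S₂) = cutGen M t z (indicator T₁ T₂) := by
  obtain ⟨τ₁, hτ₁⟩ := Finset.exists_perm_mem_iff h₁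
  obtain ⟨τ₂, hτ₂⟩ := Finset.exists_perm_mem_iff h₂
  rw [← cutGen_comp t z τ₁ τ₂ (indicator T₁ T₂)]
  congr 1
  funext h
  rcases h with h | h
  · simp [indicator, hτ₁]
  · simp [indicator, hτ₂]

theorem cutGen_nonneg (t : Bool) {z : ℝ} (hz : 0 ≤ z) (s : M.H → Bool) : 0 ≤ cutGen M t z s :=
  Finset.sum_nonneg fun σ _ => mul_nonneg (weight_nonneg σ) (by positivity)

theorem sum_indicator_le {σ : M.H → M.H} (hσ : IsPairing σ) (t : Bool) {x y z : ℝ} (hx : 0 ≤ x)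
    (hy : 0 ≤ y) (hz : 0 ≤ z) :
    ∑ S : Finset M.H₁ × Finset M.H₂, x ^ S.1.card * y ^ S.2.card * z ^ cutSize t σ (indicator S.1 S.2) ≤
      √(1 + x ^ 2) ^ M.N₁ * √(1 + y ^ 2) ^ M.N₂ *
        Real.exp (z ^ 2 * (x * M.N₁ + y * M.N₂ + if t then (M.p : ℝ) else 0)) := by
  set w : M.H → ℝ := Sum.elim (fun _ => x) (fun _ => y) with hw
  have h := sum_prod_cut_le hσ.involutive hσ.ne_self (w := w)
    (by rintro (h | h) <;> simp [hw, hx, hy]) (tw := fun h => t && crosses σ h)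
    (fun h => by rw [crosses_apply hσ.involutive]) hz
  have hR : ∏ h : M.H, (√(1 + w h ^ 2) *
      Real.exp (z ^ 2 * (w h + if (t && crosses σ h) = true then 1 / 2 else 0))) =
      √(1 + x ^ 2) ^ M.N₁ * √(1 + y ^ 2) ^ M.N₂ *
        Real.exp (z ^ 2 * (x * M.N₁ + y * M.N₂ + if t then (M.p : ℝ) else 0)) := by
    rw [Finset.prod_mul_distrib, ← Real.exp_sum, ← Finset.mul_sum]
    congr 1
    · rw [Fintype.prod_sum_type]
      simp only [hw, Sum.elim_inl, Sum.elim_inr, Finset.prod_const, Finset.card_univ, card_H₁, card_H₂]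
    · congr 2
      have e1 := hσ.card_crosses₁
      have e2 := hσ.card_crosses₂
      rw [Finset.sum_add_distrib, Fintype.sum_sum_type, Fintype.sum_sum_type]
      simp only [hw, Sum.elim_inl, Sum.elim_inr, Finset.sum_const, Finset.card_univ, card_H₁,
        card_H₂, nsmul_eq_mul]
      cases t
      · simp; ring
      -- There are `2 p` crossing half-edges, each contributing `1/2` to the exponent.
      · simp only [Bool.true_and, Finset.sum_ite, Finset.sum_const, e1, e2]
        simp
        ring
  rw [hR] at h
  refine le_trans (le_of_eq ?_) h
  refine Fintype.sum_bijective _ indicator_bijective _ _ fun S => ?_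
  rw [Finset.prod_mul_distrib]
  congr 1
  · rw [Fintype.prod_sum_type]
    simp [indicator, hw]
  · rw [Finset.prod_ite]
    simp [cutSize]

/-- All sets of the same two sizes share one generating function, so multiplying by their number
sums over them. Enlarging to all sets, with weights `x` and `y`, and exchanging the sums leaves a
bound valid for each pairing separately. -/
theorem cutGen_mul_choose_le (t : Bool) {x y z : ℝ} (hx : 0 ≤ x) (hy : 0 ≤ y) (hz : 0 ≤ z)
    (S₁ : Finset M.H₁) (S₂ : Finset M.H₂) :
    cutGen M t z (indicator S₁ S₂) * (M.N₁.choose S₁.card * M.N₂.choose S₂.card) *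
        (x ^ S₁.card * y ^ S₂.card) ≤
      √(1 + x ^ 2) ^ M.N₁ * √(1 + y ^ 2) ^ M.N₂ *
        Real.exp (z ^ 2 * (x * M.N₁ + y * M.N₂ + if t then (M.p : ℝ) else 0)) := by
  set Q := Finset.powersetCard S₁.card (Finset.univ : Finset M.H₁) ×ˢ
    Finset.powersetCard S₂.card (Finset.univ : Finset M.H₂) with hQ
  have hcard : (Q.card : ℝ) = M.N₁.choose S₁.card * M.N₂.choose S₂.card := by
    rw [hQ, Finset.card_product, Finset.card_powersetCard, Finset.card_powersetCard,
      Finset.card_univ, Finset.card_univ, card_H₁, card_H₂]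
    push_cast
    rfl
  calc _ = ∑ T ∈ Q, x ^ T.1.card * y ^ T.2.card * cutGen M t z (indicator T.1 T.2) := by
        rw [Finset.sum_congr rfl fun T hT => show _ =
          x ^ S₁.card * y ^ S₂.card * cutGen M t z (indicator S₁ S₂) from ?_]
        · rw [Finset.sum_const, nsmul_eq_mul, hcard]; ring
        · simp only [hQ, Finset.mem_product, Finset.mem_powersetCard, Finset.subset_univ,
            true_and] at hT
          rw [hT.1, hT.2, cutGen_indicator_eq t z hT.1 hT.2]
    _ ≤ ∑ T : Finset M.H₁ × Finset M.H₂, x ^ T.1.card * y ^ T.2.card * cutGen M t z (indicator T.1 T.2) :=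
        Finset.sum_le_sum_of_subset_of_nonneg (Finset.subset_univ _) fun T _ _ =>
          mul_nonneg (by positivity) (cutGen_nonneg t hz _)
    _ = ∑ σ : M.H → M.H, weight σ * ∑ T : Finset M.H₁ × Finset M.H₂,
          x ^ T.1.card * y ^ T.2.card * z ^ cutSize t σ (indicator T.1 T.2) := by
        unfold cutGen
        simp_rw [Finset.mul_sum]
        rw [Finset.sum_comm]
        exact Finset.sum_congr rfl fun σ _ => Finset.sum_congr rfl fun T _ => mul_left_comm _ _ _
    _ ≤ ∑ σ : M.H → M.H, weight σ * (√(1 + x ^ 2) ^ M.N₁ * √(1 + y ^ 2) ^ M.N₂ *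
        Real.exp (z ^ 2 * (x * M.N₁ + y * M.N₂ + if t then (M.p : ℝ) else 0))) := by
        refine Finset.sum_le_sum fun σ _ => ?_
        by_cases h0 : weight σ = 0
        · simp [h0]
        · exact mul_le_mul_of_nonneg_left
            (sum_indicator_le (isPairing_of_weight_ne_zero h0) t hx hy hz) (weight_nonneg σ)
    _ = _ := by rw [← Finset.sum_mul, sum_weight, one_mul]

/-- The previous bound at the saddle point `x² = s₁ / (N₁ - s₁)`, and likewise for `y`. It gives
`√W` over a binomial coefficient that is at least `W` up to a polynomial factor. -/
theorem cutGen_le (t : Bool) {z : ℝ} (hz : 0 ≤ z) (S₁ : Finset M.H₁) (S₂ : Finset M.H₂)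
    (h₁ : S₁.card < M.N₁) (h₂ : S₂.card < M.N₂) :
    cutGen M t z (indicator S₁ S₂) ≤
      (Real.exp 1 * (S₁.card + 1) * entropyFactor M.N₁ S₁.card ^ (-(1 / 2) : ℝ)) *
      (Real.exp 1 * (S₂.card + 1) * entropyFactor M.N₂ S₂.card ^ (-(1 / 2) : ℝ)) *
        Real.exp (z ^ 2 * (√((S₁.card : ℝ) / (M.N₁ - S₁.card)) * M.N₁ +
          √((S₂.card : ℝ) / (M.N₂ - S₂.card)) * M.N₂ + if t then (M.p : ℝ) else 0)) := by
  have h := cutGen_mul_choose_le (M := M) t (Real.sqrt_nonneg ((S₁.card : ℝ) / (M.N₁ - S₁.card)))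
    (Real.sqrt_nonneg ((S₂.card : ℝ) / (M.N₂ - S₂.card))) hz S₁ S₂
  rw [← sqrt_entropyFactor_mul_pow h₁, ← sqrt_entropyFactor_mul_pow h₂] at h
  set X := Real.exp (z ^ 2 * (√((S₁.card : ℝ) / (M.N₁ - S₁.card)) * M.N₁ +
          √((S₂.card : ℝ) / (M.N₂ - S₂.card)) * M.N₂ + if t then (M.p : ℝ) else 0)) with hX
  have hpos : ∀ {N s : ℕ}, s < N → 0 < √((s : ℝ) / (N - s)) ^ s := by
    intro N s hs
    rcases Nat.eq_zero_or_pos s with h0 | h0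
    · simp [h0]
    · have hNs : (0 : ℝ) < N - s := sub_pos.2 (by exact_mod_cast hs)
      have : (0 : ℝ) < s := by exact_mod_cast h0
      positivity
  have hp₁ := hpos h₁
  have hp₂ := hpos h₂
  have h3 : cutGen M t z (indicator S₁ S₂) * (M.N₁.choose S₁.card * M.N₂.choose S₂.card) ≤
      √(entropyFactor M.N₁ S₁.card) * √(entropyFactor M.N₂ S₂.card) * X := by
    refine le_of_mul_le_mul_right (h.trans (le_of_eq ?_)) (mul_pos hp₁ hp₂)
    ring
  have hW : ∀ {N s : ℕ}, s < N → √(entropyFactor N s) ≤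
      (Real.exp 1 * (s + 1) * entropyFactor N s ^ (-(1 / 2) : ℝ)) * N.choose s := by
    intro N s hs
    have hw := entropyFactor_pos N s
    have h4 := entropyFactor_le_mul_choose hs.le
    have h5 : √(entropyFactor N s) = entropyFactor N s * entropyFactor N s ^ (-(1 / 2) : ℝ) := by
      rw [Real.sqrt_eq_rpow, ← Real.rpow_one_add' hw.le (by norm_num)]
      norm_num
    have h6 : 0 < entropyFactor N s ^ (-(1 / 2) : ℝ) := by positivity
    rw [h5]
    nlinarith [mul_le_mul_of_nonneg_right h4 h6.le]
  have hC : (0 : ℝ) < M.N₁.choose S₁.card * M.N₂.choose S₂.card := by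
    have a1 := Nat.choose_pos h₁.le
    have a2 := Nat.choose_pos h₂.le
    exact_mod_cast Nat.mul_pos a1 a2
  refine le_of_mul_le_mul_right (h3.trans ?_) hC
  have hX0 : 0 < X := Real.exp_pos _
  have := mul_le_mul (hW h₁) (hW h₂) (Real.sqrt_nonneg _) ((Real.sqrt_nonneg _).trans (hW h₁))
  calc _ ≤ _ := mul_le_mul_of_nonneg_right this hX0.le
    _ = _ := by ring

end TwoCommunities

/-! ### The union bound -/

/-- The expansion constant of the random pairing. -/
noncomputable def expansionConst (κ : ℝ) : ℝ :=
  1 / (24 * (Real.log 200 / Real.log 2 + 1 + Real.log (1 / κ) / Real.log 2))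

theorem expansionConst_spec {κ : ℝ} (hκ : 0 < κ) (hκ1 : κ ≤ 1) :
    0 < expansionConst κ ∧ expansionConst κ ≤ 1 ∧
      expansionConst κ * (Real.log 200 / Real.log 2 + 1 + Real.log (1 / κ) / Real.log 2) = 1 / 24 := by
  have h1 : 0 ≤ Real.log 200 / Real.log 2 :=
    div_nonneg (Real.log_nonneg (by norm_num)) (Real.log_nonneg (by norm_num))
  have h2 : 0 ≤ Real.log (1 / κ) / Real.log 2 :=
    div_nonneg (Real.log_nonneg (by rw [le_div_iff₀ hκ]; linarith)) (Real.log_nonneg (by norm_num))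
  unfold expansionConst
  set K := Real.log 200 / Real.log 2 + 1 + Real.log (1 / κ) / Real.log 2
  have hK : 1 ≤ K := by simp only [K]; linarith
  refine ⟨by positivity, ?_, by field_simp⟩
  rw [div_le_one (by positivity)]
  linarith

theorem mul_log_le_mul_log_div {N s : ℕ} {q : ℝ} (hq : 0 < q) (h : q * s ≤ N) :
    s * Real.log q ≤ s * Real.log (N / s) := by
  rcases Nat.eq_zero_or_pos s with h0 | h0
  · simp [h0]
  · have hs : (0 : ℝ) < s := by exact_mod_cast h0
    refine mul_le_mul_of_nonneg_left (Real.log_le_log hq ?_) hs.le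
    rwa [le_div_iff₀ hs]

theorem exp_mul_log_le_entropyFactor {N s : ℕ} (h : s ≤ N) {c : ℝ} (hc : 0 ≤ c) :
    Real.exp (s * Real.log (N / s) * c) ≤ entropyFactor N s ^ c := by
  rw [Real.exp_mul]
  refine Real.rpow_le_rpow (Real.exp_pos _).le ?_ hc
  refine le_trans (le_of_eq ?_) (div_pow_le_entropyFactor h)
  rcases Nat.eq_zero_or_pos s with h0 | h0
  · simp [h0]
  · have hs : (0 : ℝ) < s := by exact_mod_cast h0
    have hN : (0 : ℝ) < N := by exact_mod_cast h0.trans_le h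
    rw [Real.exp_nat_mul, Real.exp_log (by positivity)]

theorem sqrt_mul_sqrt_mul_le {N₁ N s₁ s : ℕ} (hs : 0 < s) (hs₁ : s₁ ≤ s) (hN : N₁ ≤ N)
    (hN₁ : 0 < N₁) (h : 2 * s₁ ≤ N₁) :
    √((s : ℝ) / N) * (√((s₁ : ℝ) / (N₁ - s₁)) * N₁) ≤ 3 / 2 * s := by
  have a1 : (0 : ℝ) < s := by exact_mod_cast hs
  have a2 : (s₁ : ℝ) ≤ s := by exact_mod_cast hs₁
  have a3 : (N₁ : ℝ) ≤ N := by exact_mod_cast hN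
  have a4 : (0 : ℝ) < N₁ := by exact_mod_cast hN₁
  have a5 : 2 * (s₁ : ℝ) ≤ N₁ := by exact_mod_cast h
  have a6 : (0 : ℝ) < N₁ - s₁ := by linarith
  have b1 : (s : ℝ) / N ≤ s / N₁ := by gcongr
  have b2 : (s₁ : ℝ) / (N₁ - s₁) ≤ 2 * s / N₁ := by
    rw [div_le_div_iff₀ a6 a4]; nlinarith [(Nat.cast_nonneg s₁ : (0 : ℝ) ≤ s₁)]
  have b3 : √((s : ℝ) / N) * √((s₁ : ℝ) / (N₁ - s₁)) ≤ 3 / 2 * s / N₁ := by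
    rw [← Real.sqrt_mul (by positivity)]
    refine Real.sqrt_le_iff.2 ⟨by positivity, ?_⟩
    calc (s : ℝ) / N * (s₁ / (N₁ - s₁)) ≤ s / N₁ * (2 * s / N₁) := by gcongr
      _ = 2 * (s / N₁) ^ 2 := by ring
      _ ≤ 9 / 4 * (s / N₁) ^ 2 := by gcongr; norm_num
      _ = _ := by ring
  calc _ = √((s : ℝ) / N) * √((s₁ : ℝ) / (N₁ - s₁)) * N₁ := by ring
    _ ≤ 3 / 2 * s / N₁ * N₁ := by gcongr
    _ = _ := by field_simp

/-- The tilting parameter of the Chernoff bound. -/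
noncomputable def tilt (N s : ℕ) : ℝ := √(1 / 200 * √((s : ℝ) / N))

/-- The tilt satisfies `z² = √(s/N) / 200`: small enough for the exponent to be a small multiple of
`s`, yet with `-log z` only of order `1 + log(N/s)`. Each effect costs at most `L / 24`, where `exp
L` is at most the product of the two entropy factors. -/
theorem tilt_overhead_le {κ : ℝ} (hκ : 0 < κ) {N₁ N₂ s₁ s₂ : ℕ} (hκ₁ : κ * (N₁ + N₂) ≤ N₁)
    (hκ₂ : κ * (N₁ + N₂) ≤ N₂) (h₁ : 2 * s₁ ≤ N₁) (h₂ : 2 * s₂ ≤ N₂) (hN₁ : 0 < N₁) (hN₂ : 0 < N₂)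
    (hs : 0 < s₁ + s₂) {P : ℝ} (hP0 : 0 ≤ P) (hP : P ≤ 2 * (s₁ + s₂)) :
    Real.exp (tilt (N₁ + N₂) (s₁ + s₂) ^ 2 * (√((s₁ : ℝ) / (N₁ - s₁)) * N₁ +
      √((s₂ : ℝ) / (N₂ - s₂)) * N₂ + P)) ≤
      tilt (N₁ + N₂) (s₁ + s₂) ^ (expansionConst κ * (s₁ + s₂)) *
      (entropyFactor N₁ s₁ ^ (1 / 12 : ℝ) * entropyFactor N₂ s₂ ^ (1 / 12 : ℝ)) := by
  set s := s₁ + s₂ with hsdef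
  set N := N₁ + N₂ with hNdef
  have hκ1 : κ ≤ 1 := by
    have : (0 : ℝ) < N₁ := by exact_mod_cast hN₁
    have : (0 : ℝ) ≤ N₂ := by positivity
    by_contra hc
    push Not at hc
    nlinarith
  obtain ⟨hε0, -, hεK⟩ := expansionConst_spec hκ hκ1
  set ε := expansionConst κ
  have hs0 : (0 : ℝ) < s := by exact_mod_cast hs
  have hN0 : (0 : ℝ) < N := by exact_mod_cast (by omega : 0 < N)
  have hscast : (s : ℝ) = s₁ + s₂ := by simp [hsdef]
  have hNcast : (N : ℝ) = N₁ + N₂ := by simp [hNdef]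
  have hsN : (2 : ℝ) * s ≤ N := by exact_mod_cast (by omega : 2 * s ≤ N)
  set r := √((s : ℝ) / N) with hr
  have hr0 : 0 < r := by positivity
  have hr1 : r ≤ 1 := by
    exact Real.sqrt_le_one.2 (by rw [div_le_one hN0]; linarith)
  have htilt : tilt N s = √(1 / 200 * r) := rfl
  have ht0 : 0 < tilt N s := by rw [htilt]; positivity
  have ht2 : tilt N s ^ 2 = 1 / 200 * r := by rw [htilt, Real.sq_sqrt (by positivity)]
  have hlog2 : 0.6931471803 < Real.log 2 := Real.log_two_gt_d9
  set L := s₁ * Real.log (N₁ / s₁) + s₂ * Real.log (N₂ / s₂) with hL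
  have hL2 : s * Real.log 2 ≤ L := by
    have e1 := mul_log_le_mul_log_div (N := N₁) (s := s₁) (q := 2) (by norm_num) (by exact_mod_cast h₁)
    have e2 := mul_log_le_mul_log_div (N := N₂) (s := s₂) (q := 2) (by norm_num) (by exact_mod_cast h₂)
    rw [hscast]; linarith
  have hLκ : s * Real.log (κ * (N / s)) ≤ L := by
    have hq : 0 < κ * (N / s : ℝ) := by positivity
    have hle : ∀ {n k : ℕ}, k ≤ s → κ * (N : ℝ) ≤ n → κ * (N / s : ℝ) * k ≤ n := by
      intro n k hk hn
      have hk' : (k : ℝ) ≤ s := by exact_mod_cast hk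
      calc κ * (N / s : ℝ) * k ≤ κ * (N / s : ℝ) * s := by gcongr
        _ = κ * N := by field_simp
        _ ≤ n := hn
    have e1 := mul_log_le_mul_log_div (N := N₁) (s := s₁) hq (hle (by omega) (by rw [hNcast]; exact hκ₁))
    have e2 := mul_log_le_mul_log_div (N := N₂) (s := s₂) hq (hle (by omega) (by rw [hNcast]; exact hκ₂))
    rw [hscast] at e1 e2 ⊢; linarith
  have hsplit : Real.log (κ * (N / s)) = Real.log (N / s) - Real.log (1 / κ) := by
    rw [Real.log_mul hκ.ne' (by positivity), one_div, Real.log_inv]; ring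
  have hlogκ : 0 ≤ Real.log (1 / κ) := Real.log_nonneg (by rw [le_div_iff₀ hκ]; linarith)
  have hlog200 : 0 ≤ Real.log 200 := Real.log_nonneg (by norm_num)
  have hlog2' : 0 < Real.log 2 := by linarith
  have hsL : (s : ℝ) ≤ L / Real.log 2 := by rw [le_div_iff₀ hlog2']; exact hL2
  have hlogNs : 0 ≤ Real.log (N / s) := Real.log_nonneg (by rw [le_div_iff₀ hs0]; linarith)
  have hL0 : 0 ≤ L := le_trans (by positivity) hL2
  have hlogtilt : -(Real.log (tilt N s)) ≤ Real.log 200 + Real.log (N / s) := by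
    have e1 : Real.log (tilt N s) = (-(Real.log 200) + -(Real.log (N / s)) / 2) / 2 := by
      rw [htilt, Real.log_sqrt (by positivity), Real.log_mul (by norm_num) hr0.ne', hr,
        Real.log_sqrt (by positivity), one_div, Real.log_inv, ← Real.log_inv (N / s : ℝ), inv_div]
    rw [e1]; linarith
  -- The two lower bounds `L ≥ s log 2` and `L ≥ s (log (N/s) - log (1/κ))` dictate the constant in
  -- `expansionConst`.
  have hchern : ε * s * (-(Real.log (tilt N s))) ≤ L / 24 := by
    have e1 : s * (Real.log 200 + Real.log (N / s)) ≤
        (Real.log 200 / Real.log 2 + 1 + Real.log (1 / κ) / Real.log 2) * L := by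
      have f1 := mul_le_mul_of_nonneg_right hsL hlog200
      have f2 := mul_le_mul_of_nonneg_right hsL hlogκ
      rw [hsplit] at hLκ
      have : (Real.log 200 / Real.log 2 + 1 + Real.log (1 / κ) / Real.log 2) * L =
        L / Real.log 2 * Real.log 200 + L + L / Real.log 2 * Real.log (1 / κ) := by ring
      rw [this]
      linarith
    calc ε * s * (-(Real.log (tilt N s))) ≤ ε * s * (Real.log 200 + Real.log (N / s)) := by
          gcongr
      _ = ε * (s * (Real.log 200 + Real.log (N / s))) := by ring
      _ ≤ ε * ((Real.log 200 / Real.log 2 + 1 + Real.log (1 / κ) / Real.log 2) * L) := by gcongr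
      _ = L / 24 := by rw [← mul_assoc, hεK]; ring
  -- The three contributions are at most `3/2`, `3/2` and `2` times `s`, so the total is `s / 40`,
  -- below `s log 2 / 24`.
  have hover : tilt N s ^ 2 * (√((s₁ : ℝ) / (N₁ - s₁)) * N₁ +
      √((s₂ : ℝ) / (N₂ - s₂)) * N₂ + P) ≤ L / 24 := by
    have e1 := sqrt_mul_sqrt_mul_le (N := N) hs (by omega : s₁ ≤ s) (by omega) hN₁ h₁
    have e2 := sqrt_mul_sqrt_mul_le (N := N) hs (by omega : s₂ ≤ s) (by omega) hN₂ h₂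
    have e3 : r * P ≤ 2 * s := by
      rw [hscast]
      exact (mul_le_of_le_one_left hP0 hr1).trans hP
    have e4 : (s : ℝ) * 0.6931471803 ≤ s * Real.log 2 := mul_le_mul_of_nonneg_left hlog2.le hs0.le
    have e5 : 1 / 200 * r * (√((s₁ : ℝ) / (N₁ - s₁)) * N₁ + √((s₂ : ℝ) / (N₂ - s₂)) * N₂ + P) =
        1 / 200 * (r * (√((s₁ : ℝ) / (N₁ - s₁)) * N₁) + r * (√((s₂ : ℝ) / (N₂ - s₂)) * N₂) +
          r * P) := by ring
    rw [ht2, e5]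
    linarith
  rw [Real.rpow_def_of_pos ht0]
  have f1 := exp_mul_log_le_entropyFactor (by omega : s₁ ≤ N₁) (by norm_num : (0 : ℝ) ≤ 1 / 12)
  have f2 := exp_mul_log_le_entropyFactor (by omega : s₂ ≤ N₂) (by norm_num : (0 : ℝ) ≤ 1 / 12)
  refine le_trans ?_ (mul_le_mul_of_nonneg_left (mul_le_mul f1 f2 (Real.exp_pos _).le
    (Real.rpow_nonneg (entropyFactor_pos _ _).le _)) (Real.exp_pos _).le)
  rw [← Real.exp_add, ← Real.exp_add, Real.exp_le_exp, ← hscast]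
  have f3 : Real.log (tilt N s) * (ε * s) = -(ε * s * (-(Real.log (tilt N s)))) := by ring
  rw [f3]
  linarith

/-- Contribution of a set of volume `s` to the union bound. -/
noncomputable def unionTerm (N s : ℕ) : ℝ :=
  Real.exp 1 * (s + 1) * entropyFactor N s ^ (-(5 / 12) : ℝ)

theorem unionTerm_nonneg (N s : ℕ) : 0 ≤ unionTerm N s := by
  have := entropyFactor_pos N s
  unfold unionTerm
  positivity

namespace TwoCommunities

variable {M : TwoCommunities.{u}}

theorem tilt_pos {N s : ℕ} (hs : 0 < s) (hN : 0 < N) : 0 < tilt N s := by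
  unfold tilt; positivity

theorem tilt_le_one {N s : ℕ} (h : s ≤ N) : tilt N s ≤ 1 := by
  have h1 : √((s : ℝ) / N) ≤ 1 := by
    exact Real.sqrt_le_one.2 <| div_le_one_of_le₀ (by exact_mod_cast h) (by positivity)
  exact Real.sqrt_le_one.2 (by linarith)

theorem sum_weight_cutSize_lt_le {κ : ℝ} (hκ : 0 < κ) (hκ₁ : κ * M.N ≤ M.N₁) (hκ₂ : κ * M.N ≤ M.N₂)
    (t : Bool) (S₁ : Finset M.H₁) (S₂ : Finset M.H₂) (h₁ : 2 * S₁.card ≤ M.N₁)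
    (h₂ : 2 * S₂.card ≤ M.N₂) (hs : 0 < S₁.card + S₂.card)
    (ht : t = true → M.p ≤ 2 * (S₁.card + S₂.card)) :
    ∑ σ with (cutSize t σ (indicator S₁ S₂) : ℝ) < expansionConst κ * (S₁.card + S₂.card), weight σ ≤
      unionTerm M.N₁ S₁.card * unionTerm M.N₂ S₂.card := by
  have hN₁ : 0 < M.N₁ := by have := M.two_le_p; have := M.p_le_N₁; unfold N₁; omega
  have hN₂ : 0 < M.N₂ := by have := M.two_le_p; have := M.p_le_N₂; unfold N₂; omega
  set s₁ := S₁.card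
  set s₂ := S₂.card
  set z := tilt (M.N₁ + M.N₂) (s₁ + s₂) with hz
  have hz0 : 0 < z := tilt_pos hs (by omega)
  have hz1 : z ≤ 1 := tilt_le_one (by omega)
  set E := expansionConst κ * ((s₁ : ℝ) + s₂) with hE
  have hzE : 0 < z ^ E := Real.rpow_pos_of_pos hz0 _
  -- Markov's inequality for `z^cut`; since `z ≤ 1`, a small cut makes this power large.
  have hmarkov : (∑ σ with (cutSize t σ (indicator S₁ S₂) : ℝ) < E, weight σ) * z ^ E ≤
      cutGen M t z (indicator S₁ S₂) := by
    unfold cutGen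
    rw [Finset.sum_mul]
    refine le_trans (Finset.sum_le_sum fun σ hσ => mul_le_mul_of_nonneg_left ?_ (weight_nonneg σ))
      (Finset.sum_le_sum_of_subset_of_nonneg (Finset.filter_subset _ _) fun σ _ _ =>
        mul_nonneg (weight_nonneg σ) (by positivity))
    rw [← Real.rpow_natCast]
    exact Real.rpow_le_rpow_of_exponent_ge hz0 hz1 (Finset.mem_filter.1 hσ).2.le
  have hgen := cutGen_le (M := M) t hz0.le S₁ S₂ (by omega) (by omega)
  have hcast : (M.N : ℝ) = M.N₁ + M.N₂ := by simp [N]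
  have hover := tilt_overhead_le hκ (by rw [← hcast]; exact hκ₁) (by rw [← hcast]; exact hκ₂) h₁ h₂
    hN₁ hN₂ hs (P := if t then (M.p : ℝ) else 0) (by split_ifs <;> positivity) (by
      split_ifs with h
      · exact_mod_cast ht h
      · positivity)
  refine le_of_mul_le_mul_right (hmarkov.trans (hgen.trans ?_)) hzE
  have hw₁ := entropyFactor_pos M.N₁ s₁
  have hw₂ := entropyFactor_pos M.N₂ s₂
  have hcomb : ∀ W : ℝ, 0 < W → W ^ (-(5 / 12) : ℝ) = W ^ (-(1 / 2) : ℝ) * W ^ (1 / 12 : ℝ) := by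
    intro W hW
    rw [← Real.rpow_add hW]; norm_num
  unfold unionTerm
  rw [hcomb _ hw₁, hcomb _ hw₂]
  refine (mul_le_mul_of_nonneg_left hover (by positivity)).trans (le_of_eq ?_)
  ring

end TwoCommunities

/-- The total contribution of the sets of at most half of the volume to the union bound. -/
noncomputable def unionSum (N : ℕ) : ℝ :=
  ∑ s ∈ Finset.range (N / 2 + 1), Real.exp 1 * (s + 1) * (((N : ℝ) / s) ^ s) ^ (-(1 / 12) : ℝ)

/-- Grouping by volume: at most `W^(1/3)` sets, each contributing `W^(-5/12)` up to polynomial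
factors, leave `W^(-1/12)`, and `W ≥ (N/s)^s`. -/
theorem sum_unionTerm_le {V : Type*} [Fintype V] [DecidableEq V] (d : V → ℕ) (hd : ∀ v, 3 ≤ d v)
    (hN : 0 < ∑ v, d v) :
    ∑ B : Finset V with 2 * ∑ v ∈ B, d v ≤ ∑ v, d v, unionTerm (∑ v, d v) (∑ v ∈ B, d v) ≤
      unionSum (∑ v, d v) := by
  set N := ∑ v, d v with hNdef
  rw [← Finset.sum_fiberwise_of_maps_to (t := Finset.range (N / 2 + 1))
    (g := fun B : Finset V => ∑ v ∈ B, d v)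
    (fun B hB => Finset.mem_range.2 (by have := (Finset.mem_filter.1 hB).2; omega))]
  refine Finset.sum_le_sum fun s hs => ?_
  rw [Finset.mem_range] at hs
  have hsN : s < N := by omega
  have hw := entropyFactor_pos N s
  have h1 : ∑ B ∈ (Finset.univ.filter fun B : Finset V => 2 * ∑ v ∈ B, d v ≤ N) with
      ∑ v ∈ B, d v = s, unionTerm N (∑ v ∈ B, d v) ≤
      ((Finset.univ.filter fun B : Finset V => ∑ v ∈ B, d v = s).card : ℝ) * unionTerm N s := by
    rw [Finset.sum_congr rfl fun B hB => by rw [(Finset.mem_filter.1 hB).2], Finset.sum_const,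
      nsmul_eq_mul]
    refine mul_le_mul_of_nonneg_right ?_ (unionTerm_nonneg N s)
    exact_mod_cast Finset.card_le_card (Finset.filter_subset_filter _ (Finset.filter_subset _ _))
  refine h1.trans ((mul_le_mul_of_nonneg_right (card_volume_eq_le d hd hsN)
    (unionTerm_nonneg N s)).trans ?_)
  have h2 : entropyFactor N s ^ (1 / 3 : ℝ) * unionTerm N s =
      Real.exp 1 * (s + 1) * entropyFactor N s ^ (-(1 / 12) : ℝ) := by
    have : entropyFactor N s ^ (-(1 / 12) : ℝ) =
        entropyFactor N s ^ (1 / 3 : ℝ) * entropyFactor N s ^ (-(5 / 12) : ℝ) := by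
      rw [← Real.rpow_add hw]; norm_num
    rw [unionTerm, this]; ring
  rw [h2]
  have hpos : 0 < ((N : ℝ) / s) ^ s := by
    rcases Nat.eq_zero_or_pos s with h0 | h0
    · simp [h0]
    · have : (0 : ℝ) < s := by exact_mod_cast h0
      have : (0 : ℝ) < N := by exact_mod_cast hN
      positivity
  exact mul_le_mul_of_nonneg_left (Real.rpow_le_rpow_of_nonpos hpos
    (div_pow_le_entropyFactor hsN.le) (by norm_num)) (by positivity)

/-- Dominated convergence: `N/s ≥ 2` gives a geometric majorant, each term with `s ≥ 1` vanishes as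
`N` grows, and the empty set (`s = 0`) contributes exactly `e`. -/
theorem tendsto_unionSum : Tendsto unionSum atTop (𝓝 (Real.exp 1)) := by
  set F : ℕ → ℕ → ℝ := fun N s => if s < N / 2 + 1 then
    Real.exp 1 * (s + 1) * (((N : ℝ) / s) ^ s) ^ (-(1 / 12) : ℝ) else 0 with hF
  have h1 : ∀ N, unionSum N = ∑' s, F N s := by
    intro N
    rw [tsum_eq_sum (s := Finset.range (N / 2 + 1))]
    · exact Finset.sum_congr rfl fun s hs => by rw [hF]; exact (if_pos (Finset.mem_range.1 hs)).symm
    · intro s hs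
      rw [Finset.mem_range] at hs
      exact if_neg hs
  have h2 : ∑' s, (if s = 0 then Real.exp 1 else 0 : ℝ) = Real.exp 1 := tsum_ite_eq 0 _
  set ρ : ℝ := 2 ^ (-(1 / 12) : ℝ) with hρ
  have hρ0 : 0 < ρ := by positivity
  have hρ1 : ρ < 1 := Real.rpow_lt_one_of_one_lt_of_neg (by norm_num) (by norm_num)
  rw [funext h1, ← h2]
  refine tendsto_tsum_of_dominated_convergence (bound := fun s : ℕ => Real.exp 1 * (s + 1) * ρ ^ s)
    ?_ ?_ ?_
  · have a1 : Summable fun s : ℕ => (s : ℝ) * ρ ^ s := by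
      simpa using summable_pow_mul_geometric_of_norm_lt_one 1
        (by rw [Real.norm_of_nonneg hρ0.le]; exact hρ1 : ‖ρ‖ < 1)
    have a2 := summable_geometric_of_lt_one hρ0.le hρ1
    refine ((a1.add a2).mul_left (Real.exp 1)).congr fun s => by ring
  · intro s
    by_cases h0 : s = 0
    · subst h0
      simp [hF]
    · simp only [h0, if_false]
      have hs : (0 : ℝ) < s := by exact_mod_cast Nat.pos_of_ne_zero h0
      have b1 : Tendsto (fun N : ℕ => ((N : ℝ) / s) ^ s) atTop atTop :=
        (tendsto_pow_atTop h0).comp ((tendsto_natCast_atTop_atTop).atTop_div_const hs)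
      have b2 := ((tendsto_rpow_neg_atTop (by norm_num : (0 : ℝ) < 1 / 12)).comp b1).const_mul
        (Real.exp 1 * (s + 1))
      rw [mul_zero] at b2
      refine b2.congr' ?_
      filter_upwards [eventually_ge_atTop (2 * s)] with N hN
      have : s < N / 2 + 1 := by omega
      exact (if_pos this).symm
  · refine Eventually.of_forall fun N s => ?_
    simp only [hF]
    split_ifs with h
    · rw [Real.norm_of_nonneg (by positivity)]
      refine mul_le_mul_of_nonneg_left ?_ (by positivity)
      have c1 : (2 : ℝ) ^ s ≤ ((N : ℝ) / s) ^ s := by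
        rcases Nat.eq_zero_or_pos s with h0 | h0
        · simp [h0]
        · have hs : (0 : ℝ) < s := by exact_mod_cast h0
          gcongr
          rw [le_div_iff₀ hs]
          exact_mod_cast (by omega : 2 * s ≤ N)
      refine (Real.rpow_le_rpow_of_nonpos (by positivity) c1 (by norm_num)).trans (le_of_eq ?_)
      rw [hρ, ← Real.rpow_natCast, ← Real.rpow_natCast, ← Real.rpow_mul (by norm_num),
        ← Real.rpow_mul (by norm_num), mul_comm]
    · rw [norm_zero]; positivity

/-! ### Union bound over pairs of vertex sets -/

namespace TwoCommunities

variable {M : TwoCommunities.{u}}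

/-- The half-edges at a set of vertices of the first community. -/
def halfEdges₁ (B : Finset M.V₁) : Finset M.H₁ := Finset.univ.filter fun h => h.1 ∈ B

/-- The half-edges at a set of vertices of the second community. -/
def halfEdges₂ (B : Finset M.V₂) : Finset M.H₂ := Finset.univ.filter fun h => h.1 ∈ B

theorem card_filter_sigma {V : Type*} [Fintype V] [DecidableEq V] (d : V → ℕ) (B : Finset V) :
    (Finset.univ.filter fun h : Σ v : V, Fin (d v) => h.1 ∈ B).card = ∑ v ∈ B, d v := by
  have : (Finset.univ.filter fun h : Σ v : V, Fin (d v) => h.1 ∈ B) =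
      B.sigma fun v => (Finset.univ : Finset (Fin (d v))) := by
    ext h; simp
  rw [this, Finset.card_sigma]
  simp

theorem card_halfEdges₁ (B : Finset M.V₁) : (halfEdges₁ B).card = ∑ v ∈ B, M.d₁ v :=
  card_filter_sigma M.d₁ B

theorem card_halfEdges₂ (B : Finset M.V₂) : (halfEdges₂ B).card = ∑ v ∈ B, M.d₂ v :=
  card_filter_sigma M.d₂ B

/-- The pairs of vertex sets of at most half of the volume in each community. -/
noncomputable def smallPairs (M : TwoCommunities.{u}) : Finset (Finset M.V₁ × Finset M.V₂) :=
  (Finset.univ.filter fun B => 2 * ∑ v ∈ B, M.d₁ v ≤ M.N₁) ×ˢ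
    (Finset.univ.filter fun B => 2 * ∑ v ∈ B, M.d₂ v ≤ M.N₂)

/-- A pairing whose sets of at most half of the volume in each community have large boundaries. -/
structure IsExpanding (ε : ℝ) (σ : M.H → M.H) : Prop extends IsPairing σ where
  le_cutSize : ∀ B ∈ smallPairs M, ∀ t : Bool,
    (t = true → M.p ≤ 2 * ((halfEdges₁ B.1).card + (halfEdges₂ B.2).card)) →
    ε * ((halfEdges₁ B.1).card + (halfEdges₂ B.2).card) ≤
      cutSize t σ (indicator (halfEdges₁ B.1) (halfEdges₂ B.2))

-- The bounds factor over the communities, so their sum over all small pairs is at most a product of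
-- two union sums. Removing the pair of empty sets subtracts `e * e`; the factor `2` accounts for
-- the two values of `t`.
open Classical in
theorem sum_weight_not_isExpanding_le {κ ε : ℝ} (hε : ε = expansionConst κ) (hκ : 0 < κ) (hκ₁ : κ * M.N ≤ M.N₁)
    (hκ₂ : κ * M.N ≤ M.N₂) (hd₁ : ∀ v, 3 ≤ M.d₁ v) (hd₂ : ∀ v, 3 ≤ M.d₂ v) :
    ∑ σ with ¬ IsExpanding (M := M) ε σ, weight σ ≤
      2 * (unionSum M.N₁ * unionSum M.N₂ - Real.exp 1 * Real.exp 1) := by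
  have hN₁ : 0 < M.N₁ := by have := M.two_le_p; have := M.p_le_N₁; unfold N₁; omega
  have hN₂ : 0 < M.N₂ := by have := M.two_le_p; have := M.p_le_N₂; unfold N₂; omega
  set Q := (smallPairs M).erase (∅, ∅) with hQ
  set bad : Finset M.V₁ × Finset M.V₂ → Bool → Finset (M.H → M.H) := fun B t =>
    if t = true → M.p ≤ 2 * ((halfEdges₁ B.1).card + (halfEdges₂ B.2).card) then
      Finset.univ.filter fun σ => (cutSize t σ (indicator (halfEdges₁ B.1) (halfEdges₂ B.2)) : ℝ) <
        ε * ((halfEdges₁ B.1).card + (halfEdges₂ B.2).card) else ∅ with hbad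
  set g : Finset M.V₁ × Finset M.V₂ → ℝ := fun B =>
    unionTerm M.N₁ (∑ v ∈ B.1, M.d₁ v) * unionTerm M.N₂ (∑ v ∈ B.2, M.d₂ v) with hg
  have hterm : ∀ B ∈ Q, ∀ t, ∑ σ ∈ bad B t, weight σ ≤ g B := by
    intro B hB t
    have hg0 : 0 ≤ g B := mul_nonneg (unionTerm_nonneg _ _) (unionTerm_nonneg _ _)
    simp only [hbad]
    split_ifs with ht
    · rw [hQ, Finset.mem_erase, smallPairs, Finset.mem_product, Finset.mem_filter,
        Finset.mem_filter] at hB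
      have hpos : 0 < (halfEdges₁ B.1).card + (halfEdges₂ B.2).card := by
        rw [card_halfEdges₁, card_halfEdges₂]
        by_contra hc
        refine hB.1 (Prod.ext ?_ ?_)
        · refine Finset.eq_empty_of_forall_notMem fun v hv => ?_
          have := Finset.single_le_sum (fun v _ => Nat.zero_le (M.d₁ v)) hv
          have := hd₁ v
          omega
        · refine Finset.eq_empty_of_forall_notMem fun v hv => ?_
          have := Finset.single_le_sum (fun v _ => Nat.zero_le (M.d₂ v)) hv
          have := hd₂ v
          omega
      have h := sum_weight_cutSize_lt_le hκ hκ₁ hκ₂ t (halfEdges₁ B.1) (halfEdges₂ B.2)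
        (by rw [card_halfEdges₁]; exact hB.2.1.2) (by rw [card_halfEdges₂]; exact hB.2.2.2) hpos ht
      simp only [hg, ← card_halfEdges₁, ← card_halfEdges₂, hε]
      exact h
    · simpa using hg0
  have hcover : ∀ σ, ¬ IsExpanding ε σ → weight σ ≤
      ∑ B ∈ Q, ∑ t, if σ ∈ bad B t then weight σ else 0 := by
    intro σ hσ
    -- Maps of weight zero need not be pairings, but they contribute nothing.
    by_cases h0 : weight σ = 0
    · simp [h0]
    · have hp := isPairing_of_weight_ne_zero h0
      have hex : ∃ B ∈ Q, ∃ t, σ ∈ bad B t := by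
        by_contra hc
        push Not at hc
        refine hσ ⟨hp, fun B hB t ht => ?_⟩
        by_cases hB0 : B = (∅, ∅)
        · subst hB0
          simp [halfEdges₁, halfEdges₂]
        · have := hc B (Finset.mem_erase.2 ⟨hB0, hB⟩) t
          simp only [hbad, if_pos ht, Finset.mem_filter, Finset.mem_univ, true_and, not_lt] at this
          exact this
      obtain ⟨B, hB, t, ht⟩ := hex
      have hnn : ∀ B t, 0 ≤ if σ ∈ bad B t then weight σ else 0 := fun B t => by
        split_ifs
        exacts [weight_nonneg σ, le_rfl]
      calc weight σ = if σ ∈ bad B t then weight σ else 0 := by rw [if_pos ht]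
        _ ≤ ∑ t, if σ ∈ bad B t then weight σ else 0 :=
          Finset.single_le_sum (f := fun t => if σ ∈ bad B t then weight σ else 0)
            (fun t _ => hnn B t) (Finset.mem_univ t)
        _ ≤ _ := Finset.single_le_sum (f := fun B => ∑ t, if σ ∈ bad B t then weight σ else 0)
            (fun B _ => Finset.sum_nonneg fun t _ => hnn B t) hB
  have hsumg : ∑ B ∈ Q, g B ≤ unionSum M.N₁ * unionSum M.N₂ - Real.exp 1 * Real.exp 1 := by
    have hmem : ((∅, ∅) : Finset M.V₁ × Finset M.V₂) ∈ smallPairs M := by simp [smallPairs]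
    have h1 := Finset.sum_erase_add (smallPairs M) g hmem
    have h2 : g (∅, ∅) = Real.exp 1 * Real.exp 1 := by
      simp [hg, unionTerm, entropyFactor_zero]
    have h3 : ∑ B ∈ smallPairs M, g B ≤ unionSum M.N₁ * unionSum M.N₂ := by
      rw [smallPairs, Finset.sum_product]
      simp only [hg]
      simp_rw [← Finset.mul_sum]
      rw [← Finset.sum_mul]
      have e1 := sum_unionTerm_le M.d₁ hd₁ hN₁
      have e2 := sum_unionTerm_le M.d₂ hd₂ hN₂
      exact mul_le_mul e1 e2 (Finset.sum_nonneg fun _ _ => unionTerm_nonneg _ _)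
        ((Finset.sum_nonneg fun _ _ => unionTerm_nonneg _ _).trans e1)
    rw [← hQ, h2] at h1
    linarith
  calc ∑ σ with ¬ IsExpanding ε σ, weight σ
      ≤ ∑ σ with ¬ IsExpanding ε σ, ∑ B ∈ Q, ∑ t, if σ ∈ bad B t then weight σ else 0 :=
        Finset.sum_le_sum fun σ hσ => hcover σ (Finset.mem_filter.1 hσ).2
    _ ≤ ∑ σ, ∑ B ∈ Q, ∑ t, if σ ∈ bad B t then weight σ else 0 :=
        Finset.sum_le_sum_of_subset_of_nonneg (Finset.filter_subset _ _) fun σ _ _ =>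
          Finset.sum_nonneg fun B _ => Finset.sum_nonneg fun t _ => by
            split_ifs
            exacts [weight_nonneg σ, le_rfl]
    _ = ∑ B ∈ Q, ∑ t, ∑ σ ∈ bad B t, weight σ := by
        rw [Finset.sum_comm]
        refine Finset.sum_congr rfl fun B _ => ?_
        rw [Finset.sum_comm]
        refine Finset.sum_congr rfl fun t _ => ?_
        rw [← Finset.sum_filter]
        simp
    _ ≤ ∑ B ∈ Q, 2 * g B := by
        refine Finset.sum_le_sum fun B hB => ?_
        rw [Fintype.sum_bool]
        linarith [hterm B hB true, hterm B hB false]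
    _ = 2 * ∑ B ∈ Q, g B := by rw [Finset.mul_sum]
    _ ≤ _ := by linarith

end TwoCommunities

/-! ### Expanding pairings have a large spectral profile -/

namespace TwoCommunities

variable {M : TwoCommunities.{u}}

/-- The half-edges of the first community, as half-edges of the graph. -/
def leftSide (M : TwoCommunities.{u}) : Finset M.H := Finset.univ.filter fun h => h.isLeft = true

theorem card_filter_leftSide (P : M.H → Prop) [DecidablePred P] :
    ((leftSide M).filter P).card = (Finset.univ.filter fun h : M.H₁ => P (Sum.inl h)).card := by
  rw [← Finset.card_map (Function.Embedding.inl : M.H₁ ↪ M.H)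
    (s := Finset.univ.filter fun h : M.H₁ => P (Sum.inl h))]
  congr 1
  ext h
  rcases h with h | h <;> simp [leftSide]

theorem card_filter_leftSide_compl (P : M.H → Prop) [DecidablePred P] :
    ((leftSide M)ᶜ.filter P).card = (Finset.univ.filter fun h : M.H₂ => P (Sum.inr h)).card := by
  rw [← Finset.card_map (Function.Embedding.inr : M.H₂ ↪ M.H)
    (s := Finset.univ.filter fun h : M.H₂ => P (Sum.inr h))]
  congr 1
  ext h
  rcases h with h | h <;> simp [leftSide]

theorem card_leftSide : (leftSide M).card = M.N₁ := by
  have := card_filter_leftSide (M := M) fun _ => True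
  simpa [N₁] using this

theorem card_leftSide_compl : (leftSide M)ᶜ.card = M.N₂ := by
  have := card_filter_leftSide_compl (M := M) fun _ => True
  simpa [N₂] using this

/-- Complementing a set inside the first community flips its indicator on exactly one end of each
crossing edge, which the twist in `cutSize` undoes. -/
theorem cutSize_indicator_filter (t : Bool) (σ : M.H → M.H) (A : Finset M.V) :
    cutSize t σ (indicator
      (halfEdges₁ (Finset.univ.filter fun v => (decide (Sum.inl v ∈ A) ^^ t) = true))
      (halfEdges₂ (Finset.univ.filter fun v => Sum.inr v ∈ A))) =
    (Finset.univ.filter fun h => ¬ (M.vertex h ∈ A ↔ M.vertex (σ h) ∈ A)).card := by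
  unfold cutSize
  congr 1
  ext h
  have hconf : ∀ h : M.H, indicator
      (halfEdges₁ (Finset.univ.filter fun v => (decide (Sum.inl v ∈ A) ^^ t) = true))
      (halfEdges₂ (Finset.univ.filter fun v => Sum.inr v ∈ A)) h =
      (decide (M.vertex h ∈ A) ^^ (t && h.isLeft)) := by
    rintro (h | h)
    · by_cases hh : Sum.inl h.1 ∈ A <;> cases t <;> simp [indicator, halfEdges₁, vertex, hh]
    · by_cases hh : Sum.inr h.1 ∈ A <;> cases t <;> simp [indicator, halfEdges₂, vertex, hh]
  simp only [Finset.mem_filter, Finset.mem_univ, true_and, hconf, crosses]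
  by_cases h1 : M.vertex h ∈ A <;> by_cases h2 : M.vertex (σ h) ∈ A <;>
    cases t <;> cases h.isLeft <;> cases (σ h).isLeft <;> simp [h1, h2]

theorem card_indicator_eq_true (S₁ : Finset M.H₁) (S₂ : Finset M.H₂) :
    (Finset.univ.filter fun h => indicator S₁ S₂ h = true).card = S₁.card + S₂.card := by
  rw [Finset.card_filter, Fintype.sum_sum_type]
  simp [indicator]

/-- A crossing edge missing the set at both ends is cut in the twisted sense. This settles the
twisted sets whose difference from the first community has volume less than `p / 2`. -/
theorem two_mul_p_le_cutSize {σ : M.H → M.H} (hσ : IsPairing σ) (S₁ : Finset M.H₁)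
    (S₂ : Finset M.H₂) :
    2 * M.p ≤ cutSize true σ (indicator S₁ S₂) + 2 * (S₁.card + S₂.card) := by
  have h1 : (Finset.univ.filter fun h => crosses σ h = true).card = 2 * M.p := by
    have e1 := hσ.card_crosses₁
    have e2 := hσ.card_crosses₂
    rw [Finset.card_filter] at e1 e2 ⊢
    rw [Fintype.sum_sum_type, e1, e2, two_mul]
  have h2 : (Finset.univ.filter fun h => indicator S₁ S₂ (σ h) = true).card = S₁.card + S₂.card := by
    rw [← card_indicator_eq_true S₁ S₂]
    exact Finset.card_equiv hσ.involutive.toPerm fun h => by simp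
  have h3 : (Finset.univ.filter fun h => crosses σ h = true) ⊆
      (Finset.univ.filter fun h => (indicator S₁ S₂ h ^^ indicator S₁ S₂ (σ h) ^^
        (true && crosses σ h)) = true) ∪
      ((Finset.univ.filter fun h => indicator S₁ S₂ h = true) ∪
        (Finset.univ.filter fun h => indicator S₁ S₂ (σ h) = true)) := by
    intro h hh
    simp only [Finset.mem_filter, Finset.mem_univ, true_and, Finset.mem_union] at hh ⊢
    rw [hh]
    cases indicator S₁ S₂ h <;> cases indicator S₁ S₂ (σ h) <;> simp
  have h4 := Finset.card_le_card h3
  have h5 := h4.trans ((Finset.card_union_le _ _).trans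
    (Nat.add_le_add_left (Finset.card_union_le _ _) _))
  rw [h1, card_indicator_eq_true, h2] at h5
  unfold cutSize
  omega

theorem IsExpanding.aligned {ε : ℝ} (hε : 0 ≤ ε) {σ : M.H → M.H} (hσ : IsExpanding ε σ)
    (A : Finset M.V)
    (h₁ : 2 * ((leftSide M).filter fun h => M.vertex h ∈ A).card ≤ (leftSide M).card)
    (h₂ : 2 * ((leftSide M)ᶜ.filter fun h => M.vertex h ∈ A).card ≤ (leftSide M)ᶜ.card) :
    ε / 3 * (Finset.univ.filter fun h => M.vertex h ∈ A).card ≤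
      (Finset.univ.filter fun h => ¬ (M.vertex h ∈ A ↔ M.vertex (σ h) ∈ A)).card := by
  rw [← cutSize_indicator_filter false]
  set B₁ : Finset M.V₁ := Finset.univ.filter fun v => (decide (Sum.inl v ∈ A) ^^ false) = true
  set B₂ : Finset M.V₂ := Finset.univ.filter fun v => Sum.inr v ∈ A
  have e1 : (halfEdges₁ B₁).card = ((leftSide M).filter fun h => M.vertex h ∈ A).card := by
    rw [card_filter_leftSide]; congr 1; ext h
    rw [halfEdges₁, Finset.mem_filter, Finset.mem_filter, Finset.mem_filter]; simp [vertex]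
  have e2 : (halfEdges₂ B₂).card = ((leftSide M)ᶜ.filter fun h => M.vertex h ∈ A).card := by
    rw [card_filter_leftSide_compl]; congr 1; ext h
    rw [halfEdges₂, Finset.mem_filter, Finset.mem_filter, Finset.mem_filter]; simp [vertex]
  rw [card_leftSide, ← e1] at h₁
  rw [card_leftSide_compl, ← e2] at h₂
  have e3 : (Finset.univ.filter fun h => M.vertex h ∈ A).card =
      (halfEdges₁ B₁).card + (halfEdges₂ B₂).card := by
    rw [e1, e2, ← Finset.card_union_of_disjoint
      (Finset.disjoint_filter_filter disjoint_compl_right), ← Finset.filter_union,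
      Finset.union_compl]
  have h := hσ.le_cutSize (B₁, B₂) (by
    rw [smallPairs, Finset.mem_product, Finset.mem_filter, Finset.mem_filter,
      ← card_halfEdges₁, ← card_halfEdges₂]
    exact ⟨⟨Finset.mem_univ _, h₁⟩, ⟨Finset.mem_univ _, h₂⟩⟩) false (by simp)
  refine le_trans ?_ h
  rw [e3]
  push_cast
  -- There is room to spare: the factor `1/3` only matches the constant of the twisted case.
  have : (0 : ℝ) ≤ (halfEdges₁ B₁).card + (halfEdges₂ B₂).card := by positivity
  nlinarith [mul_nonneg hε this]

theorem IsExpanding.twisted {ε : ℝ} (hε : 0 ≤ ε) (hε1 : ε ≤ 1) {σ : M.H → M.H}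
    (hσ : IsExpanding ε σ) (A : Finset M.V)
    (h₁ : 2 * ((leftSide M).filter fun h => M.vertex h ∉ A).card ≤ (leftSide M).card)
    (h₂ : 2 * ((leftSide M)ᶜ.filter fun h => M.vertex h ∈ A).card ≤ (leftSide M)ᶜ.card) :
    ε / 3 * (M.p + ((leftSide M).filter fun h => M.vertex h ∉ A).card +
      ((leftSide M)ᶜ.filter fun h => M.vertex h ∈ A).card) ≤
      (Finset.univ.filter fun h => ¬ (M.vertex h ∈ A ↔ M.vertex (σ h) ∈ A)).card := by
  rw [← cutSize_indicator_filter true]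
  set B₁ : Finset M.V₁ := Finset.univ.filter fun v => (decide (Sum.inl v ∈ A) ^^ true) = true
  set B₂ : Finset M.V₂ := Finset.univ.filter fun v => Sum.inr v ∈ A
  have e1 : (halfEdges₁ B₁).card = ((leftSide M).filter fun h => M.vertex h ∉ A).card := by
    rw [card_filter_leftSide]; congr 1; ext h
    rw [halfEdges₁, Finset.mem_filter, Finset.mem_filter, Finset.mem_filter]; simp [vertex]
  have e2 : (halfEdges₂ B₂).card = ((leftSide M)ᶜ.filter fun h => M.vertex h ∈ A).card := by
    rw [card_filter_leftSide_compl]; congr 1; ext h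
    rw [halfEdges₂, Finset.mem_filter, Finset.mem_filter, Finset.mem_filter]; simp [vertex]
  rw [card_leftSide, ← e1] at h₁
  rw [card_leftSide_compl, ← e2] at h₂
  rw [← e1, ← e2]
  set s₁ := (halfEdges₁ B₁).card with hs₁
  set s₂ := (halfEdges₂ B₂).card with hs₂
  -- If `p ≤ 2 (s₁ + s₂)`, the probabilistic bound also covers the term `p`. Otherwise the
  -- deterministic bound leaves a cut of at least `p`.
  by_cases hp : M.p ≤ 2 * (s₁ + s₂)
  · have h := hσ.le_cutSize (B₁, B₂) (by
      rw [smallPairs, Finset.mem_product, Finset.mem_filter, Finset.mem_filter,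
        ← card_halfEdges₁, ← card_halfEdges₂]
      exact ⟨⟨Finset.mem_univ _, h₁⟩, ⟨Finset.mem_univ _, h₂⟩⟩) true (fun _ => hp)
    refine le_trans ?_ h
    have hp' : (M.p : ℝ) ≤ 2 * (s₁ + s₂) := by exact_mod_cast hp
    have := mul_le_mul_of_nonneg_left hp' hε
    simp only [← hs₁, ← hs₂]
    linarith
  · have h := two_mul_p_le_cutSize hσ.toIsPairing (halfEdges₁ B₁) (halfEdges₂ B₂)
    rw [← hs₁, ← hs₂] at h
    have h' : M.p + s₁ + s₂ ≤ 3 * cutSize true σ (indicator (halfEdges₁ B₁) (halfEdges₂ B₂)) := by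
      omega
    have h'' : (M.p : ℝ) + s₁ + s₂ ≤
        3 * cutSize true σ (indicator (halfEdges₁ B₁) (halfEdges₂ B₂)) := by exact_mod_cast h'
    have h0 : (0 : ℝ) ≤ (M.p : ℝ) + s₁ + s₂ := by positivity
    nlinarith

/-- The constant in the Poincaré inequality of an expanding pairing. -/
noncomputable def poincareConst (ε : ℝ) : ℝ := ε / 3 / (8 * (36 / (ε / 3) + 6))

theorem IsExpanding.energy_ge {ε : ℝ} (hε : 0 < ε) (hε1 : ε ≤ 1) {σ : M.H → M.H}
    (hσ : IsExpanding ε σ) (f : M.V → ℝ) (hf : ∀ x, 0 ≤ f x)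
    (hsupp : 2 * ∑ x with f x ≠ 0, M.d x ≤ M.N) :
    poincareConst ε * (M.p / M.N) * ∑ h, f (M.vertex h) ^ 2 ≤
      ∑ h, (f (M.vertex h) - f (M.vertex (σ h))) ^ 2 := by
  have hN₁ : 0 < M.N₁ := by have := M.two_le_p; have := M.p_le_N₁; unfold N₁; omega
  have hN₂ : 0 < M.N₂ := by have := M.two_le_p; have := M.p_le_N₂; unfold N₂; omega
  have hL : (leftSide M).Nonempty := Finset.card_pos.1 (by rw [card_leftSide]; exact hN₁)
  have hR : (leftSide M)ᶜ.Nonempty := Finset.card_pos.1 (by rw [card_leftSide_compl]; exact hN₂)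
  have hp : M.p ≤ Fintype.card M.H := by rw [card_H]; exact p_le_N
  have hsum : ((leftSide M).filter fun h => f (M.vertex h) ≠ 0).card +
      ((leftSide M)ᶜ.filter fun h => f (M.vertex h) ≠ 0).card = ∑ x with f x ≠ 0, M.d x := by
    rw [← Finset.card_union_of_disjoint
      (Finset.disjoint_filter_filter disjoint_compl_right), ← Finset.filter_union,
      Finset.union_compl]
    have h := sum_halfEdge (M := M) fun x => if f x ≠ 0 then 1 else 0
    rw [Finset.card_filter, Finset.sum_filter]
    have h' : ((∑ h : M.H, if f (M.vertex h) ≠ 0 then 1 else 0 : ℕ) : ℝ) =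
        ((∑ x, if f x ≠ 0 then M.d x else 0 : ℕ) : ℝ) := by
      push_cast
      simpa using h
    exact_mod_cast h'
  have hal := hσ.aligned hε.le
  have htw := hσ.twisted hε.le hε1
  rw [← card_H, poincareConst]
  -- A support of at most half of the total volume occupies at most half of at least one community;
  -- the other one then plays the role of `X`.
  have hcases : 2 * ((leftSide M)ᶜ.filter fun h => f (M.vertex h) ≠ 0).card ≤ (leftSide M)ᶜ.card ∨
      2 * ((leftSide M).filter fun h => f (M.vertex h) ≠ 0).card ≤ (leftSide M).card := by
    rw [card_leftSide, card_leftSide_compl]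
    have : M.N = M.N₁ + M.N₂ := rfl
    omega
  rcases hcases with h | h
  · exact energy_ge_of_expansion σ M.vertex (leftSide M) hL M.p hp (by positivity) hal htw f hf h
  · refine energy_ge_of_expansion σ M.vertex (leftSide M)ᶜ hR M.p hp (by positivity) ?_ ?_ f hf
      (by rw [compl_compl]; exact h)
    · intro A h1 h2
      rw [compl_compl] at h2
      exact hal A h2 h1
    · intro A h1 h2
      rw [compl_compl] at h2 ⊢
      -- Passing to the complement exchanges the communities: `A` and `Aᶜ` have the same boundary,
      -- and `A` differs from one community exactly where `Aᶜ` differs from the other.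
      have h3 := htw Aᶜ (by simpa using h2) (by simpa using h1)
      simp only [Finset.mem_compl, not_not, not_iff_not] at h3
      rw [add_assoc, add_comm ((((leftSide M)ᶜ.filter fun h => M.vertex h ∉ A).card : ℕ) : ℝ),
        ← add_assoc]
      exact h3

theorem poincareConst_pos {ε : ℝ} (hε : 0 < ε) : 0 < poincareConst ε := by
  unfold poincareConst; positivity

theorem poincareConst_le_one {ε : ℝ} (hε : 0 < ε) (hε1 : ε ≤ 1) : poincareConst ε ≤ 1 := by
  unfold poincareConst
  have h : 0 < 36 / (ε / 3) := by positivity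
  rw [div_le_one (by positivity)]
  linarith

theorem IsExpanding.le_spectralProfile {ε κ : ℝ} (hε : 0 < ε) (hε1 : ε ≤ 1) (hκ : 0 < κ)
    (hκ1 : κ ≤ 1) (hn : 2 ≤ M.n) (hα : M.α ≤ 1) (hκ₁ : κ * M.N ≤ M.N₁) (hκ₂ : κ * M.N ≤ M.N₂)
    {σ : M.H → M.H} (hσ : IsExpanding ε σ) :
    poincareConst ε * κ / 8 * M.α ≤ spectralProfile (lazyWalk σ) M.stationary (1 / 2) := by
  have hc0 := poincareConst_pos hε
  have hc1 := poincareConst_le_one hε hε1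
  have hN : (0 : ℝ) < M.N := by exact_mod_cast N_pos
  have hκN : 0 < κ * M.N := by positivity
  have hα0 : 0 ≤ M.α := by unfold α; positivity
  -- Both `N₁` and `N₂` are at least `κ N`, so `α` is at most `2 / κ` times `p / N`.
  have hα2 : κ / 2 * M.α ≤ M.p / M.N := by
    have e1 : (M.p : ℝ) / M.N₁ ≤ M.p / (κ * M.N) := by gcongr
    have e2 : (M.p : ℝ) / M.N₂ ≤ M.p / (κ * M.N) := by gcongr
    calc κ / 2 * M.α ≤ κ / 2 * (M.p / (κ * M.N) + M.p / (κ * M.N)) := by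
          unfold α; gcongr
      _ = M.p / M.N := by field_simp; ring
  refine le_spectralProfile_of_energy_ge hσ.involutive hn ?_ fun f hf hsupp => ?_
  · calc poincareConst ε * κ / 8 * M.α ≤ 1 * 1 / 8 * 1 := by gcongr
      _ ≤ 1 := by norm_num
  · refine le_trans ?_ (hσ.energy_ge hε hε1 f hf hsupp)
    refine mul_le_mul_of_nonneg_right ?_ (Finset.sum_nonneg fun h _ => sq_nonneg _)
    calc 4 * (poincareConst ε * κ / 8 * M.α) = poincareConst ε * (κ / 2 * M.α) := by ring
      _ ≤ _ := by gcongr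

theorem toOuterMeasure_law_ge {κ : ℝ} (hκ : 0 < κ) (hκ1 : κ ≤ 1) (hn : 2 ≤ M.n) (hα : M.α ≤ 1)
    (hκ₁ : κ * M.N ≤ M.N₁) (hκ₂ : κ * M.N ≤ M.N₂) (hd : ∀ v, 3 ≤ M.d v) :
    ENNReal.ofReal (1 - 2 * (unionSum M.N₁ * unionSum M.N₂ - Real.exp 1 * Real.exp 1)) ≤
      M.law.toOuterMeasure {σ | poincareConst (expansionConst κ) * κ / 8 * M.α ≤
          spectralProfile (lazyWalk σ) M.stationary (1 / 2)} := by
  classical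
  obtain ⟨hε, hε1, -⟩ := expansionConst_spec hκ hκ1
  refine ENNReal.ofReal_le_of_le_toReal ?_
  rw [toOuterMeasure_law_toReal]
  have h1 := sum_weight_not_isExpanding_le rfl hκ hκ₁ hκ₂ (fun v => hd (Sum.inl v))
    (fun v => hd (Sum.inr v))
  have h2 := Finset.sum_filter_add_sum_filter_not Finset.univ
    (fun σ : M.H → M.H => IsExpanding (expansionConst κ) σ) weight
  rw [sum_weight] at h2
  have h3 : ∑ σ with IsExpanding (M := M) (expansionConst κ) σ, weight σ ≤
      ∑ σ with σ ∈ {σ | poincareConst (expansionConst κ) * κ / 8 * M.α ≤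
          spectralProfile (lazyWalk σ) M.stationary (1 / 2)}, weight σ := by
    refine Finset.sum_le_sum_of_subset_of_nonneg ?_ fun σ _ _ => weight_nonneg σ
    exact Finset.monotone_filter_right _ fun σ _ hσ =>
      hσ.le_spectralProfile hε hε1 hκ hκ1 hn hα hκ₁ hκ₂
  linarith

theorem n_le_N : M.n ≤ M.N := by
  rw [← sum_d, n, Fintype.card_eq_sum_ones]
  exact Finset.sum_le_sum fun x _ => (two_le_d x).trans' (by norm_num)

end TwoCommunities

theorem proposition4p8 (Δ : ℕ) (κ a : ℝ) (hκ : 0 < κ) (ha : 0 < a) :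
    ∃ c : ℝ, 0 < c ∧ ∀ M : ℕ → TwoCommunities.{u},
      Tendsto (fun k => (M k).n) atTop atTop →
      (∀ k, (M k).α ≤ 1) →
      (∀ k, κ * (M k).N ≤ (M k).N₁ ∧ κ * (M k).N ≤ (M k).N₂) →
      (∀ k v, 3 ≤ (M k).d v) →
      (∀ k v, (M k).d v ≤ Δ) →
      (∀ k, a / Real.log (M k).n ≤ (M k).α) →
      Tendsto (fun k => (M k).law.toOuterMeasure
        {σ | c * (M k).α ≤
          spectralProfile (TwoCommunities.lazyWalk σ) (M k).stationary (1 / 2)})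
        atTop (𝓝 1) := by
  by_cases hκ1 : κ ≤ 1
  · obtain ⟨hε, hε1, -⟩ := expansionConst_spec hκ hκ1
    have hc := TwoCommunities.poincareConst_pos hε
    refine ⟨TwoCommunities.poincareConst (expansionConst κ) * κ / 8, by positivity, ?_⟩
    intro M hn hα hN hd _ _
    have hNtop : Tendsto (fun k => κ * ((M k).N : ℝ)) atTop atTop :=
      (tendsto_natCast_atTop_atTop.comp (tendsto_atTop_mono
        (fun k => TwoCommunities.n_le_N (M := M k)) hn)).const_mul_atTop hκ
    have hN₁ : Tendsto (fun k => (M k).N₁) atTop atTop :=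
      tendsto_natCast_atTop_iff.1 (tendsto_atTop_mono (fun k => (hN k).1) hNtop)
    have hN₂ : Tendsto (fun k => (M k).N₂) atTop atTop :=
      tendsto_natCast_atTop_iff.1 (tendsto_atTop_mono (fun k => (hN k).2) hNtop)
    -- Both community volumes are at least `κ n`, so both union sums tend to `e` and the failure
    -- bound `2 (e² - e²)` vanishes in the limit.
    have hlim : Tendsto (fun k => ENNReal.ofReal (1 - 2 * (unionSum (M k).N₁ * unionSum (M k).N₂ -
        Real.exp 1 * Real.exp 1))) atTop (𝓝 1) := by
      have h := ((((tendsto_unionSum.comp hN₁).mul (tendsto_unionSum.comp hN₂)).sub_const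
        (Real.exp 1 * Real.exp 1)).const_mul 2).const_sub 1
      rw [sub_self, mul_zero, sub_zero] at h
      have := ENNReal.tendsto_ofReal h
      rwa [ENNReal.ofReal_one] at this
    refine tendsto_of_tendsto_of_tendsto_of_le_of_le' hlim tendsto_const_nhds ?_ ?_
    · filter_upwards [hn.eventually_ge_atTop 2] with k hk
      exact TwoCommunities.toOuterMeasure_law_ge hκ hκ1 hk (hα k) (hN k).1 (hN k).2 (hd k)
    · refine Eventually.of_forall fun k => ?_
      refine (MeasureTheory.measure_mono (Set.subset_univ _)).trans (le_of_eq ?_)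
      rw [PMF.toOuterMeasure_apply_eq_one_iff]
      exact Set.subset_univ _
  -- For `κ > 1` no such sequence exists, since `N₁ ≤ N`; any constant serves.
  · refine ⟨1, one_pos, fun M _ _ hN _ _ _ => ?_⟩
    have h := (hN 0).1
    have h1 : (0 : ℝ) < (M 0).N := by exact_mod_cast TwoCommunities.N_pos
    have h2 : ((M 0).N₁ : ℝ) ≤ (M 0).N := by
      exact_mod_cast Nat.le_add_right (M 0).N₁ (M 0).N₂
    nlinarith
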